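/- Let $(M,g)$ be a connected closed smooth Riemannian manifold of dimension $d\ge 2$, let $T'M=T^*M\setminus\{0\}$, and let $h(y,\eta)=\left(g^{\alpha\beta}(y)\,\eta_\alpha\eta_\beta\right)^{1/2}$ on $T'M$. Let $(x^*(t;y,\eta),\xi^*(t;y,\eta))$, $t\in\mathbb R$, $(y,\eta)\in T'M$, be the Hamiltonian (cogeodesic) flow: the global solution of $\dot x^*=h_\xi(x^*,\xi^*)$, $\dot\xi^*=-h_x(x^*,\xi^*)$ with $(x^*,\xi^*)|_{t=0}=(y,\eta)$. Fix $\epsilon>0$ and let $\varphi(t,x;y,\eta;\epsilon)$ be a Levi-Civita phase function, that is, an infinitely smooth complex-valued function of $(t,x,(y,\eta))\in\mathbb R\times M\times T'M$ with $\operatorname{Im}\varphi\ge0$ such that, for $x$ in a geodesic neighbourhood of $x^*=x^*(t;y,\eta)$, $$\varphi(t,x;y,\eta;\epsilon)=\int_\gamma\zeta\,dz+\frac{i\epsilon}{2}\,h(y,\eta)\,\operatorname{dist}^2(x,x^*),$$ where $\gamma$ is the unique shortest geodesic from $x^*$ to $x$, $\zeta$ is the parallel transport of $\xi^*(t;y,\eta)$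 along $\gamma$ with respect to the Levi-Civita connection, and $\operatorname{dist}$ is the Riemannian distance. (A geodesic neighbourhood of $z$ is the image under $\exp_z$ of an open star-shaped neighbourhood of $0\in T_zM$ on which $\exp_z$ is a diffeomorphism.) Then, in any local coordinates near $x^*$ and any local coordinates near $y$, for all $t\in\mathbb R$ and $(y,\eta)\in T'M$, the coordinates of $x^*$ and the components of $\xi^*$ are differentiable functions of $(\eta_1,\dots,\eta_d)$, and for all $\alpha,\beta\in\{1,\dots,d\}$ $$\varphi_{x^\alpha\eta_\beta}\Big|_{x=x^*}=\frac{\partial\xi^*_\alpha}{\partial\eta_\beta}-\Gamma^\mu{}_{\alpha\nu}(x^*)\,\xi^*_\mu\,\frac{\partial x^{*\nu}}{\partial\eta_\beta}-i\,\epsilon\,h(y,\eta)\,g_{\alpha\nu}(x^*)\,\frac{\partial x^{*\nu}}{\partial\eta_\beta},$$ where $\Gamma^\mu{}_{\alpha\nu}$ are the Christoffel symbols of $g$ and repeated indices are summed from $1$ to $d$. -/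

import Mathlib

open Set Bundle Manifold MeasureTheory
open scoped ContDiff Topology

noncomputable section

namespace LeviCivitaPhase

/-- The coordinate space `ℝᵈ`. -/
abbrev Coord (d : ℕ) : Type := EuclideanSpace ℝ (Fin d)

/-- The partial derivative `∂f/∂uᵅ` of a function of `d` real variables. -/
def pderiv {d : ℕ} {F : Type*} [NormedAddCommGroup F] [NormedSpace ℝ F]
    (f : Coord d → F) (u : Coord d) (α : Fin d) : F :=
  fderiv ℝ f u (EuclideanSpace.single α (1 : ℝ))

section Manifold

variable {d : ℕ} {M : Type*} [MetricSpace M] [ChartedSpace (Coord d) M] [IsManifold (𝓡 d) ∞ M]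

/-- Local coordinates on `M` (charts of the smooth structure). -/
abbrev IsCoordSystem (e : OpenPartialHomeomorph M (Coord d)) : Prop :=
  e ∈ IsManifold.maximalAtlas (𝓡 d) ∞ M

variable (d M) in
/-- The cotangent bundle `T*M`; a point is a pair `⟨y, η⟩` with `η` a linear form on `T_y M`. -/
abbrev Cotangent : Type _ :=
  TotalSpace (Coord d →L[ℝ] ℝ) (fun x : M => TangentSpace (𝓡 d) x →L[ℝ] ℝ)

/-- The coordinate differential `dxᵅ` at `x`. -/
def dCoord (e : OpenPartialHomeomorph M (Coord d)) (x : M) (α : Fin d) :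
    TangentSpace (𝓡 d) x →L[ℝ] ℝ :=
  mfderiv (𝓡 d) 𝓘(ℝ, ℝ) (fun z => e z α) x

/-- The coordinate vector `∂/∂xᵅ` at `x`. -/
def coordVec (e : OpenPartialHomeomorph M (Coord d)) (x : M) (α : Fin d) :
    TangentSpace (𝓡 d) x :=
  (mfderiv (𝓡 d) (𝓡 d) e x).inverse (EuclideanSpace.single α (1 : ℝ) : Coord d)

/-- The covector `∑ q_α dxᵅ` at `x` with components `q`. -/
def covec (e : OpenPartialHomeomorph M (Coord d)) (x : M) (q : Coord d) :
    TangentSpace (𝓡 d) x →L[ℝ] ℝ :=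
  ∑ α, q α • dCoord e x α

/-- The components `ξ_α = ξ(∂/∂xᵅ)` of a covector. -/
def components (e : OpenPartialHomeomorph M (Coord d)) (p : Cotangent d M) : Coord d :=
  WithLp.toLp 2 fun α => p.2 (coordVec e p.1 α)

variable [RiemannianBundle (fun x : M => TangentSpace (𝓡 d) x)]

/-- The matrix `g_{μν}(x)` of the Riemannian metric in the coordinates `e`. -/
def metricMatrix (e : OpenPartialHomeomorph M (Coord d)) (x : M) : Matrix (Fin d) (Fin d) ℝ :=
  Matrix.of fun μ ν => inner ℝ (coordVec e x μ) (coordVec e x ν)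

/-- The partial derivative `∂g_{μν}/∂xˢ` at `x` in the coordinates `e`. -/
def dMetric (e : OpenPartialHomeomorph M (Coord d)) (x : M) (s μ ν : Fin d) : ℝ :=
  pderiv (fun u => metricMatrix e (e.symm u) μ ν) (e x) s

/-- The Christoffel symbol
`Γ^μ_{αν} = ½ g^{μs} (∂_α g_{sν} + ∂_ν g_{sα} - ∂_s g_{αν})` at `x` in the coordinates `e`. -/
def christoffel (e : OpenPartialHomeomorph M (Coord d)) (x : M) (μ α ν : Fin d) : ℝ :=
  (1 / 2) * ∑ s, (metricMatrix e x)⁻¹ μ s *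
    (dMetric e x α s ν + dMetric e x ν s α - dMetric e x s α ν)

/-- The Hamiltonian `h(x, ξ) = (g^{αβ}(x) ξ_α ξ_β)^{1/2}`. The value does not depend on the local
coordinates in which the right-hand side is computed; we take those of the preferred chart
at `x`. -/
def hamiltonian (p : Cotangent d M) : ℝ :=
  Real.sqrt (∑ α, ∑ β, (metricMatrix (chartAt (Coord d) p.1) p.1)⁻¹ α β *
    components (chartAt (Coord d) p.1) p α * components (chartAt (Coord d) p.1) p β)

/-- `Φ t (y, η) = (x*(t; y, η), ξ*(t; y, η))` is the global flow on `T'M = T*M ∖ 0` of Hamilton's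
equations `ẋ* = h_ξ(x*, ξ*)`, `ξ̇* = -h_x(x*, ξ*)` with `(x*, ξ*) = (y, η)` at `t = 0`. The
equations are required in all local coordinates `e`. No regularity in `(y, η)` is required. The
values of `Φ` on the zero section are irrelevant. -/
structure IsHamiltonianFlow (h : Cotangent d M → ℝ)
    (Φ : ℝ → Cotangent d M → Cotangent d M) : Prop where
  initial : ∀ p : Cotangent d M, p.2 ≠ 0 → Φ 0 p = p
  ne_zero : ∀ (t : ℝ) (p : Cotangent d M), p.2 ≠ 0 → (Φ t p).2 ≠ 0
  continuous_base : ∀ p : Cotangent d M, p.2 ≠ 0 → Continuous fun t => (Φ t p).1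
  position : ∀ p : Cotangent d M, p.2 ≠ 0 → ∀ (t : ℝ) (e : OpenPartialHomeomorph M (Coord d)),
    IsCoordSystem e → (Φ t p).1 ∈ e.source → ∀ α : Fin d,
      HasDerivAt (fun s => e (Φ s p).1 α)
        (pderiv (fun q : Coord d => h ⟨(Φ t p).1, covec e (Φ t p).1 q⟩)
          (components e (Φ t p)) α) t
  momentum : ∀ p : Cotangent d M, p.2 ≠ 0 → ∀ (t : ℝ) (e : OpenPartialHomeomorph M (Coord d)),
    IsCoordSystem e → (Φ t p).1 ∈ e.source → ∀ α : Fin d,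
      HasDerivAt (fun s => components e (Φ s p) α)
        (-pderiv (fun u : Coord d =>
          h ⟨e.symm u, covec e (e.symm u) (components e (Φ t p))⟩) (e (Φ t p).1) α) t

/-- `γ : [0, 1] → M` is a geodesic: `γ̈^μ + Γ^μ_{αν}(γ) γ̇^α γ̇^ν = 0` in all local coordinates.
Values of `γ` outside `[0, 1]` are irrelevant. -/
structure IsGeodesic (γ : ℝ → M) : Prop where
  smooth : ContMDiffOn 𝓘(ℝ, ℝ) (𝓡 d) ∞ γ (Icc 0 1)
  equation : ∀ s ∈ Icc (0 : ℝ) 1, ∀ e : OpenPartialHomeomorph M (Coord d),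
    IsCoordSystem e → γ s ∈ e.source → ∀ μ : Fin d,
      derivWithin (fun r => derivWithin (fun τ => e (γ τ) μ) (Icc 0 1) r) (Icc 0 1) s
        + ∑ α, ∑ ν, christoffel e (γ s) μ α ν
            * derivWithin (fun τ => e (γ τ) α) (Icc 0 1) s
            * derivWithin (fun τ => e (γ τ) ν) (Icc 0 1) s = 0

/-- The velocity `γ̇(s)` of a path `γ : [0, 1] → M`. -/
def velocity (γ : ℝ → M) (s : ℝ) : TangentSpace (𝓡 d) (γ s) :=
  mfderivWithin 𝓘(ℝ, ℝ) (𝓡 d) γ (Icc 0 1) s (1 : ℝ)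

/-- `exp_z v = x`: the geodesic with initial point `z` and initial velocity `v` is at `x` at
time `1`. -/
def IsExp (z : M) (v : TangentSpace (𝓡 d) z) (x : M) : Prop :=
  ∃ γ : ℝ → M, IsGeodesic (d := d) γ ∧
    (⟨γ 0, velocity γ 0⟩ : TangentBundle (𝓡 d) M) = ⟨z, v⟩ ∧ γ 1 = x

/-- `U` is a geodesic neighbourhood of `z`: the image under `exp_z` of an open star-shaped
neighbourhood of `0` in `T_z M` on which `exp_z` is a diffeomorphism (onto its open image). -/
def IsGeodesicNhd (z : M) (U : Set M) : Prop :=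
  ∃ E : OpenPartialHomeomorph (TangentSpace (𝓡 d) z) M,
    0 ∈ E.source ∧ StarConvex ℝ 0 E.source ∧ E.target = U ∧
    (∀ v ∈ E.source, IsExp z v (E v)) ∧
    ContMDiffOn 𝓘(ℝ, TangentSpace (𝓡 d) z) (𝓡 d) ∞ E E.source ∧
    ContMDiffOn (𝓡 d) 𝓘(ℝ, TangentSpace (𝓡 d) z) ∞ E.symm E.target

/-- `γ : [0, 1] → M` is a shortest geodesic from `z` to `x`: its length is the Riemannian
distance. -/
structure IsShortestGeodesic (γ : ℝ → M) (z x : M) : Prop where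
  isGeodesic : IsGeodesic (d := d) γ
  start : γ 0 = z
  finish : γ 1 = x
  shortest : pathELength (𝓡 d) γ 0 1 = edist z x

/-- The covectors `ζ s ∈ T*_{γ s} M` are parallel along `γ : [0, 1] → M`:
`ζ̇_α = Γ^μ_{αν}(γ) ζ_μ γ̇^ν` in all local coordinates. -/
def IsParallelAlong (γ : ℝ → M) (ζ : (s : ℝ) → TangentSpace (𝓡 d) (γ s) →L[ℝ] ℝ) : Prop :=
  ∀ s ∈ Icc (0 : ℝ) 1, ∀ e : OpenPartialHomeomorph M (Coord d),
    IsCoordSystem e → γ s ∈ e.source → ∀ α : Fin d,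
      HasDerivWithinAt (fun r => components e ⟨γ r, ζ r⟩ α)
        (∑ μ, ∑ ν, christoffel e (γ s) μ α ν * components e ⟨γ s, ζ s⟩ μ
          * derivWithin (fun τ => e (γ τ) ν) (Icc 0 1) s) (Icc 0 1) s

/-- `φ t x (y, η) = φ(t, x; y, η; ε)` is a Levi-Civita phase function with parameter `ε`, for the
flow `Φ t (y, η) = (x*, ξ*)`: a smooth function on `ℝ × M × T'M` with `Im φ ≥ 0` such that, for
`x` in a geodesic neighbourhood of `x*`,
`φ = ∫_γ ζ dz + (i ε / 2) h(y, η) dist²(x, x*)`, where `γ` is the unique shortest geodesic from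
`x*` to `x` and `ζ` is the parallel transport of `ξ*` along `γ`. -/
structure IsLeviCivitaPhase (ε : ℝ) (Φ : ℝ → Cotangent d M → Cotangent d M)
    (φ : ℝ → M → Cotangent d M → ℂ) : Prop where
  smooth : ContMDiffOn
    (𝓘(ℝ, ℝ).prod ((𝓡 d).prod ((𝓡 d).prod 𝓘(ℝ, Coord d →L[ℝ] ℝ)))) 𝓘(ℝ, ℂ) ∞
    (fun q : ℝ × M × Cotangent d M => φ q.1 q.2.1 q.2.2) {q | q.2.2.2 ≠ 0}
  im_nonneg : ∀ (t : ℝ) (x : M) (p : Cotangent d M), p.2 ≠ 0 → 0 ≤ (φ t x p).im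
  formula : ∀ (t : ℝ) (p : Cotangent d M), p.2 ≠ 0 →
    ∃ U : Set M, IsGeodesicNhd (d := d) (Φ t p).1 U ∧ ∀ x ∈ U,
      ∃ (γ : ℝ → M) (ζ : (s : ℝ) → TangentSpace (𝓡 d) (γ s) →L[ℝ] ℝ),
        IsShortestGeodesic (d := d) γ (Φ t p).1 x ∧
        (∀ γ' : ℝ → M, IsShortestGeodesic (d := d) γ' (Φ t p).1 x → EqOn γ' γ (Icc 0 1)) ∧
        IsParallelAlong γ ζ ∧
        (⟨γ 0, ζ 0⟩ : Cotangent d M) = Φ t p ∧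
        φ t x p = ((∫ s in (0 : ℝ)..1, ζ s (velocity γ s) : ℝ) : ℂ)
          + Complex.I * (ε : ℂ) / 2 * (hamiltonian p : ℂ) * ((dist x (Φ t p).1 : ℝ) : ℂ) ^ 2

/-! The flow and the phase function in local coordinates `ex` for `x` and `ey` for `y`, with `t` and
`y` fixed, as functions of the components `q` of the covector at `y` (and of the coordinates `u`
of `x`). -/

/-- The coordinates of `x*(t; y, η)` as functions of the components `q` of `η`. -/
def xStar (Φ : ℝ → Cotangent d M → Cotangent d M) (ex ey : OpenPartialHomeomorph M (Coord d))
    (t : ℝ) (y : M) (q : Coord d) : Coord d :=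
  ex (Φ t ⟨y, covec ey y q⟩).1

/-- The components of `ξ*(t; y, η)` as functions of the components `q` of `η`. -/
def xiStar (Φ : ℝ → Cotangent d M → Cotangent d M) (ex ey : OpenPartialHomeomorph M (Coord d))
    (t : ℝ) (y : M) (q : Coord d) : Coord d :=
  components ex (Φ t ⟨y, covec ey y q⟩)

/-- `φ(t, x; y, η)` as a function of the coordinates `u` of `x` and the components `q` of `η`. -/
def phaseInCoords (φ : ℝ → M → Cotangent d M → ℂ) (ex ey : OpenPartialHomeomorph M (Coord d))
    (t : ℝ) (y : M) (u q : Coord d) : ℂ :=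
  φ t (ex.symm u) ⟨y, covec ey y q⟩

/-- The mixed second derivative `φ_{x^α η_β}` at the point with coordinates `u` and `q`. -/
def mixedHessian (φ : ℝ → M → Cotangent d M → ℂ) (ex ey : OpenPartialHomeomorph M (Coord d))
    (t : ℝ) (y : M) (u q : Coord d) (α β : Fin d) : ℂ :=
  pderiv (fun q' => pderiv (fun u' => phaseInCoords φ ex ey t y u' q') u α) q β

end Manifold

end LeviCivitaPhase

end

open LeviCivitaPhase

/-! Parallel transport preserves the pairing of a covector with the velocity of a geodesic, so along
a shortest geodesic `γ` from `x*` to `x` the phase is the quadratic polynomial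
`s ⟨ξ*, γ̇(0)⟩ + (i ε h / 2) s² dist²(x, x*)`. The initial velocities of shortest geodesics form a
cone that approximates every direction to first order, and hence at `x*` the differential of `φ` in
`x` is `ξ*` and its second differential is `(v, w) ↦ ξ*(Γ(v, w)) + i ε h ⟨v, w⟩`.

In particular `x*` is a nondegenerate critical point of `Im φ`. The implicit function theorem
expresses it, near each `(t, η)`, by a function that is differentiable in `η`; the identity
`x* = y` at `t = 0` and the continuity of the flow lines in `t` propagate this to all times, so no
theorem on the dependence of solutions on initial data is needed. Then `ξ*` is differentiable as
the value of `∂φ/∂x` at `x*`, and differentiating `∂φ/∂x (t, x*; y, η) = ξ*` in `η` gives the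
formula. -/

noncomputable section

namespace LeviCivitaPhase

section Homogeneous

variable {E : Type*} [NormedAddCommGroup E] [NormedSpace ℝ E]

lemma eventually_le_mul_norm_pow_of_homogeneous {X : Type*} [TopologicalSpace X] [ProperSpace E]
    {N : X → E → ℝ} {n : ℕ} {C : ℝ} {z : X} (hn : n ≠ 0)
    (hN : ∀ v, ContinuousAt (fun p : X × E => N p.1 p.2) (z, v))
    (hhom : ∀ x (r : ℝ) v, 0 ≤ r → N x (r • v) = r ^ n * N x v)
    (hC : ∀ v, ‖v‖ = 1 → N z v < C) :
    ∀ᶠ x in 𝓝 z, ∀ v, N x v ≤ C * ‖v‖ ^ n := by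
  have hsphere : ∀ᶠ x in 𝓝 z, ∀ v ∈ Metric.sphere (0 : E) 1, N x v < C :=
    (isCompact_sphere 0 1).eventually_forall_of_forall_eventually fun v hv =>
      (hN v).eventually_lt_const (hC v (by simpa using hv))
  filter_upwards [hsphere] with x hx v
  rcases eq_or_ne v 0 with rfl | hv
  · simpa [hn] using (hhom x 0 0 le_rfl).le
  have hunit : ‖(‖v‖⁻¹ : ℝ) • v‖ = 1 := norm_smul_inv_norm (𝕜 := ℝ) hv
  calc N x v = ‖v‖ ^ n * N x (‖v‖⁻¹ • v) := by
        rw [← hhom x _ _ (norm_nonneg v), smul_inv_smul₀ (norm_ne_zero_iff.2 hv)]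
    _ ≤ ‖v‖ ^ n * C := by gcongr; exact (hx _ (by simpa using hunit)).le
    _ = C * ‖v‖ ^ n := mul_comm _ _

lemma mem_of_isClosed_cone {K : Set E} (hK : IsClosed K)
    (hcone : ∀ r > (0 : ℝ), ∀ k ∈ K, r • k ∈ K)
    (happrox : ∀ δ > 0, ∀ᶠ w in 𝓝 (0 : E), ∃ k ∈ K, ‖w - k‖ ≤ δ * ‖w‖) (u : E) : u ∈ K := by
  rw [← hK.closure_eq, Metric.mem_closure_iff]
  intro ε hε
  have hδ : 0 < ε / (‖u‖ + 1) := by positivity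
  have hlim : Filter.Tendsto (fun r : ℝ => r • u) (𝓝[>] 0) (𝓝 0) :=
    tendsto_nhdsWithin_of_tendsto_nhds
      ((continuous_id.smul continuous_const).tendsto' 0 0 (zero_smul ℝ u))
  obtain ⟨r, ⟨k, hk, hrk⟩, hr : 0 < r⟩ :=
    ((hlim.eventually (happrox _ hδ)).and self_mem_nhdsWithin).exists
  refine ⟨r⁻¹ • k, hcone _ (inv_pos.2 hr) k hk, ?_⟩
  calc dist u (r⁻¹ • k) = r⁻¹ * ‖r • u - k‖ := by
        rw [dist_eq_norm, ← norm_smul_of_nonneg (inv_nonneg.2 hr.le), smul_sub,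
          inv_smul_smul₀ hr.ne']
    _ ≤ r⁻¹ * (ε / (‖u‖ + 1) * (r * ‖u‖)) := by
        rw [← norm_smul_of_nonneg hr.le]
        gcongr
    _ = ε * (‖u‖ / (‖u‖ + 1)) := by field_simp
    _ < ε := mul_lt_of_lt_one_right hε ((div_lt_one (by positivity)).2 (lt_add_one _))

end Homogeneous

section Curves

variable {E F : Type*} [NormedAddCommGroup E] [NormedSpace ℝ E]
  [NormedAddCommGroup F] [NormedSpace ℝ F]

lemma eq_apply_zero_of_hasDerivWithinAt_zero {f : ℝ → E}
    (hf : ∀ s ∈ Icc (0 : ℝ) 1, HasDerivWithinAt f 0 (Icc 0 1) s) {s : ℝ}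
    (hs : s ∈ Icc (0 : ℝ) 1) : f s = f 0 := by
  refine constant_of_derivWithin_zero (fun r hr => (hf r hr).differentiableWithinAt)
    (fun r hr => (hf r (Ico_subset_Icc_self hr)).derivWithin
      (uniqueDiffOn_Icc zero_lt_one r (Ico_subset_Icc_self hr))) s hs

lemma norm_sub_sub_le_of_norm_deriv_deriv_le {f V A : ℝ → E} {B : ℝ} (hB : 0 ≤ B)
    (hf : ∀ s ∈ Icc (0 : ℝ) 1, HasDerivWithinAt f (V s) (Icc 0 1) s)
    (hV : ∀ s ∈ Icc (0 : ℝ) 1, HasDerivWithinAt V (A s) (Icc 0 1) s)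
    (hA : ∀ s ∈ Icc (0 : ℝ) 1, ‖A s‖ ≤ B) : ‖f 1 - f 0 - V 0‖ ≤ B := by
  have h0 : (0 : ℝ) ∈ Icc (0 : ℝ) 1 := unitInterval.zero_mem
  have hVB : ∀ s ∈ Icc (0 : ℝ) 1, ‖V s - V 0‖ ≤ B := fun s hs =>
    calc ‖V s - V 0‖ ≤ B * ‖s - 0‖ :=
          (convex_Icc (0 : ℝ) 1).norm_image_sub_le_of_norm_hasDerivWithin_le hV hA h0 hs
      _ ≤ B := mul_le_of_le_one_right hB (by simpa [abs_of_nonneg hs.1] using hs.2)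
  have hsub : ∀ s ∈ Icc (0 : ℝ) 1,
      HasDerivWithinAt (fun r => f r - r • V 0) (V s - V 0) (Icc 0 1) s := fun s hs => by
    simpa using (hf s hs).fun_sub ((hasDerivWithinAt_id s _).smul_const (V 0))
  simpa [sub_right_comm] using (convex_Icc (0 : ℝ) 1).norm_image_sub_le_of_norm_hasDerivWithin_le
    hsub hVB h0 unitInterval.one_mem

variable {f : E → F} {k V : ℝ → E} {A : E} {a b : F}

lemma eventually_fderiv_apply_of_eq_along_curve (hf : ∀ᶠ u in 𝓝 (k 0), DifferentiableAt ℝ f u)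
    (hk : ∀ᶠ s in 𝓝[Icc 0 1] (0 : ℝ), HasDerivWithinAt k (V s) (Icc 0 1) s)
    (heq : ∀ᶠ s in 𝓝[Icc 0 1] (0 : ℝ), f (k s) = s • a + s ^ 2 • b) :
    ∀ᶠ s in 𝓝[Icc 0 1] (0 : ℝ), fderiv ℝ f (k s) (V s) = a + (2 * s) • b := by
  have hpoly : ∀ s : ℝ, HasDerivAt (fun s : ℝ => s • a + s ^ 2 • b) (a + (2 * s) • b) s :=
    fun s => by
      simpa using ((hasDerivAt_id s).smul_const a).fun_add ((hasDerivAt_pow 2 s).smul_const b)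
  have hfk : ∀ᶠ s in 𝓝[Icc 0 1] (0 : ℝ), DifferentiableAt ℝ f (k s) :=
    (hk.self_of_nhdsWithin unitInterval.zero_mem).continuousWithinAt.eventually hf
  filter_upwards [eventually_eventually_nhdsWithin.2 heq, hk, hfk, eventually_mem_nhdsWithin]
    with s hs hks hfs hsI
  exact (uniqueDiffOn_Icc zero_lt_one s hsI).eq_deriv _
    (hfs.hasFDerivAt.comp_hasDerivWithinAt s hks)
    ((hpoly s).hasDerivWithinAt.congr_of_eventuallyEq hs (hs.self_of_nhdsWithin hsI))

lemma fderiv_fderiv_apply_of_eq_along_curve (hf : ContDiffAt ℝ 2 f (k 0))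
    (hk : ∀ᶠ s in 𝓝[Icc 0 1] (0 : ℝ), HasDerivWithinAt k (V s) (Icc 0 1) s)
    (hV : HasDerivWithinAt V A (Icc 0 1) 0)
    (heq : ∀ᶠ s in 𝓝[Icc 0 1] (0 : ℝ), f (k s) = s • a + s ^ 2 • b) :
    fderiv ℝ f (k 0) (V 0) = a ∧
      fderiv ℝ (fderiv ℝ f) (k 0) (V 0) (V 0) + fderiv ℝ f (k 0) A = (2 : ℝ) • b := by
  have h0 : (0 : ℝ) ∈ Icc (0 : ℝ) 1 := unitInterval.zero_mem
  have hfirst := eventually_fderiv_apply_of_eq_along_curve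
    ((hf.eventually (by simp)).mono fun u hu => hu.differentiableAt two_ne_zero) hk heq
  have hchain : HasDerivWithinAt (fun s => fderiv ℝ f (k s) (V s))
      (fderiv ℝ (fderiv ℝ f) (k 0) (V 0) (V 0) + fderiv ℝ f (k 0) A) (Icc 0 1) 0 :=
    (((hf.fderiv_right (m := 1) le_rfl).differentiableAt one_ne_zero).hasFDerivAt
      |>.comp_hasDerivWithinAt 0 (hk.self_of_nhdsWithin h0)).clm_apply hV
  have hlinear : HasDerivWithinAt (fun s : ℝ => a + (2 * s) • b) ((2 : ℝ) • b) (Icc 0 1) 0 := by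
    simpa using ((((hasDerivAt_id (0 : ℝ)).const_mul 2).smul_const b).const_add a).hasDerivWithinAt
  exact ⟨by simpa using hfirst.self_of_nhdsWithin h0,
    (uniqueDiffOn_Icc zero_lt_one 0 h0).eq_deriv _ hchain
      (hlinear.congr_of_eventuallyEq hfirst (hfirst.self_of_nhdsWithin h0))⟩

end Curves

section ImplicitFunction

variable {E₁ E₂ F : Type*} [NormedAddCommGroup E₁] [NormedSpace ℝ E₁]
  [NormedAddCommGroup E₂] [NormedSpace ℝ E₂] [NormedAddCommGroup F] [NormedSpace ℝ F]

lemma fderiv_comp_prodMk_right {P : E₁ × E₂ → F} {p : E₁ × E₂} (h : DifferentiableAt ℝ P p) :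
    fderiv ℝ (fun u => P (p.1, u)) p.2 = fderiv ℝ P p ∘L .inr ℝ E₁ E₂ :=
  (h.hasFDerivAt.comp p.2 (hasFDerivAt_prodMk_right p.1 p.2)).fderiv

lemma contDiffAt_fderiv_comp_prodMk_right {m n : ℕ∞ω} (hmn : m + 1 ≤ n) {P : E₁ × E₂ → F}
    {p : E₁ × E₂} (h : ContDiffAt ℝ n P p) :
    ContDiffAt ℝ m (fun p => fderiv ℝ (fun u => P (p.1, u)) p.2) p := by
  have hP : ContDiffAt ℝ n (Function.uncurry fun (q : E₁ × E₂) u => P (q.1, u)) (p, p.2) :=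
    h.comp (p, p.2) (by fun_prop)
  exact hP.fderiv contDiffAt_snd hmn

variable [FiniteDimensional ℝ E₂]

lemma isInvertible_of_apply_self_ne_zero {B : E₂ →L[ℝ] E₂ →L[ℝ] ℝ}
    (hB : ∀ v, v ≠ 0 → B v v ≠ 0) : B.IsInvertible := by
  let B' : E₂ →ₗ[ℝ] Module.Dual ℝ E₂ := LinearMap.toContinuousLinearMap.symm.toLinearMap ∘ₗ B
  have hinj : Function.Injective B' := by
    refine (injective_iff_map_eq_zero B').2 fun v hv => ?_
    by_contra hne
    exact hB v hne (DFunLike.congr_fun hv v)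
  exact ⟨(LinearMap.linearEquivOfInjective B' hinj Subspace.dual_finrank_eq.symm
    ≪≫ₗ LinearMap.toContinuousLinearMap).toContinuousLinearEquiv, by ext; rfl⟩

lemma exists_contDiffAt_implicit_of_definite [CompleteSpace E₁] {n : ℕ∞ω} (hn : n ≠ 0)
    {G : E₁ × E₂ → E₂ →L[ℝ] ℝ} {p : E₁ × E₂} (hG : ContDiffAt ℝ n G p)
    (hdef : ∀ v, v ≠ 0 → fderiv ℝ G p (0, v) v ≠ 0) :
    ∃ X : E₁ → E₂, ContDiffAt ℝ n X p.1 ∧ ∀ᶠ q in 𝓝 p, G q = G p → q.2 = X q.1 := by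
  have hcomplete : CompleteSpace E₂ := FiniteDimensional.complete ℝ E₂
  have hinv : (fderiv ℝ G p ∘L .inr ℝ E₁ E₂).IsInvertible :=
    isInvertible_of_apply_self_ne_zero hdef
  exact ⟨hG.implicitFunction hn hinv, hG.contDiffAt_implicitFunction hn hinv,
    (hG.eventually_apply_eq_iff_implicitFunction hn hinv).mono fun q hq h => (hq.1 h).symm⟩

end ImplicitFunction

section Propagation

variable {T Q M : Type*} [TopologicalSpace T] [LocallyConnectedSpace T] [TopologicalSpace Q]
  [TopologicalSpace M] [RegularSpace M] {c X : T × Q → M} {t₀ : T} {q₀ : Q}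

/-- A slice `c (·, q)` cannot leave the neighbourhood in which `X` isolates it: inside, it agrees
with `X` and so keeps away from the boundary. -/
lemma eventually_eventuallyEq_of_isolated (hc : ∀ᶠ q in 𝓝 q₀, Continuous fun t => c (t, q))
    (hX : ContinuousAt X (t₀, q₀))
    (hiso : ∀ᶠ p in 𝓝 ((t₀, q₀), c (t₀, q₀)), p.2 = c p.1 → p.2 = X p.1) :
    ∀ᶠ t₁ in 𝓝 t₀, ContinuousAt (fun q => c (t₁, q)) q₀ → c =ᶠ[𝓝 (t₀, q₀)] X := by
  have hX₀ : c (t₀, q₀) = X (t₀, q₀) := hiso.self_of_nhds rfl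
  rw [nhds_prod_eq, Filter.eventually_prod_iff] at hiso
  obtain ⟨P, hP, S, hS, hPS⟩ := hiso
  obtain ⟨K, hK, hKclosed, hKS⟩ := exists_mem_nhds_isClosed_subset hS
  have hKX : ∀ᶠ a in 𝓝 (t₀, q₀), P a ∧ X a ∈ interior K :=
    hP.and (hX.eventually_mem (hX₀ ▸ interior_mem_nhds.2 hK))
  rw [nhds_prod_eq, Filter.eventually_prod_iff] at hKX
  obtain ⟨I, hI, B, hB, hIB⟩ := hKX
  obtain ⟨J, ⟨hJo, hJ₀, hJ⟩, hJI⟩ :=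
    (LocallyConnectedSpace.open_connected_basis t₀).mem_iff.1 hI
  have hgap : ∀ t ∈ J, ∀ q, B q → c (t, q) ∈ K → c (t, q) ∈ interior K ∧ c (t, q) = X (t, q) := by
    intro t ht q hq hcK
    obtain ⟨hPa, hXK⟩ := hIB (hJI ht) hq
    have heq : c (t, q) = X (t, q) := hPS hPa (hKS hcK) rfl
    exact ⟨heq ▸ hXK, heq⟩
  have hstart : ∀ᶠ t₁ in 𝓝 t₀, c (t₁, q₀) ∈ interior K :=
    hc.self_of_nhds.continuousAt.eventually_mem (interior_mem_nhds.2 hK)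
  filter_upwards [hstart, hJo.mem_nhds hJ₀] with t₁ ht₁K ht₁ hcont
  have hstay : ∀ᶠ q in 𝓝 q₀, ∀ t ∈ J, c (t, q) = X (t, q) := by
    filter_upwards [hcont.eventually_mem (isOpen_interior.mem_nhds ht₁K), hB, hc]
      with q hq hBq hcq t ht
    have hsub : (fun t => c (t, q)) '' J ⊆ interior K := by
      refine (hJ.isPreconnected.image _ hcq.continuousOn).subset_left_of_subset_union
        isOpen_interior hKclosed.isOpen_compl (disjoint_compl_right.mono_left interior_subset) ?_
        ⟨_, mem_image_of_mem _ ht₁, hq⟩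
      rintro _ ⟨t, ht, rfl⟩
      exact (em (c (t, q) ∈ K)).imp (fun h => (hgap t ht q hBq h).1) id
    exact (hgap t ht q hBq (interior_subset (hsub (mem_image_of_mem _ ht)))).2
  filter_upwards [prod_mem_nhds (hJo.mem_nhds hJ₀) hstay] with a ha using ha.2 a.1 ha.1

lemma continuousAt_of_forall_isolated [PreconnectedSpace T]
    (hc : ∀ᶠ q in 𝓝 q₀, Continuous fun t => c (t, q))
    (hloc : ∀ t, ∃ X : T × Q → M, (∀ᶠ a in 𝓝 (t, q₀), ContinuousAt X a) ∧
      ∀ᶠ p in 𝓝 ((t, q₀), c (t, q₀)), p.2 = c p.1 → p.2 = X p.1)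
    {t₁ : T} (ht₁ : ContinuousAt (fun q => c (t₁, q)) q₀) (t : T) : ContinuousAt c (t, q₀) := by
  have hslice : ∀ {t}, ContinuousAt c (t, q₀) → ContinuousAt (fun q => c (t, q)) q₀ :=
    fun h => h.comp (f := fun q => (_, q)) (by fun_prop)
  have hopen : IsOpen {t | ContinuousAt c (t, q₀)} := by
    refine isOpen_iff_eventually.2 fun t ht => ?_
    obtain ⟨X, hX, hiso⟩ := hloc t
    have hev : ∀ᶠ a in 𝓝 (t, q₀), ContinuousAt c a := by
      filter_upwards [hX, ((continuousAt_id.prodMk ht).eventually hiso).eventually_nhds]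
        with a ha heq
      exact ha.congr (heq.mono fun b hb => (hb rfl).symm)
    exact (Continuous.prodMk_left q₀).continuousAt.eventually hev
  have hnear : ∀ t, ∀ᶠ s in 𝓝 t, ContinuousAt (fun q => c (s, q)) q₀ → ContinuousAt c (t, q₀) := by
    intro t
    obtain ⟨X, hX, hiso⟩ := hloc t
    filter_upwards [eventually_eventuallyEq_of_isolated hc hX.self_of_nhds hiso] with s hs hcont
    exact hX.self_of_nhds.congr (hs hcont).symm
  have hclosed : IsClosed {t | ContinuousAt c (t, q₀)} := by
    refine isClosed_iff_frequently.2 fun t ht => ?_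
    obtain ⟨s, hs, hsc⟩ := (ht.and_eventually (hnear t)).exists
    exact hsc (hslice hs)
  have huniv := IsClopen.eq_univ ⟨hclosed, hopen⟩ ⟨t₁, (hnear t₁).self_of_nhds ht₁⟩
  exact huniv.ge (mem_univ t)

end Propagation

section Coordinates

variable {d : ℕ} {M : Type*} [MetricSpace M] [ChartedSpace (Coord d) M]

/-- The components of a tangent vector at `x` in the local coordinates `e`. -/
def vecComponents (e : OpenPartialHomeomorph M (Coord d)) (x : M) :
    TangentSpace (𝓡 d) x →L[ℝ] Coord d :=
  mfderiv (𝓡 d) (𝓡 d) e x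

/-- The tangent vector at `x` with given components in the local coordinates `e`. -/
def vecOfComponents (e : OpenPartialHomeomorph M (Coord d)) (x : M) :
    Coord d →L[ℝ] TangentSpace (𝓡 d) x :=
  (mfderiv (𝓡 d) (𝓡 d) e x).inverse

lemma vecOfComponents_single (e : OpenPartialHomeomorph M (Coord d)) (x : M) (α : Fin d) :
    vecOfComponents e x (EuclideanSpace.single α (1 : ℝ)) = coordVec e x α := rfl

lemma vecOfComponents_eq_sum (e : OpenPartialHomeomorph M (Coord d)) (x : M) (v : Coord d) :
    vecOfComponents e x v = ∑ α, v α • coordVec e x α := by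
  conv_lhs => rw [← (EuclideanSpace.basisFun (Fin d) ℝ).sum_repr v]
  simp [vecOfComponents_single]

lemma apply_vecOfComponents (e : OpenPartialHomeomorph M (Coord d)) (p : Cotangent d M)
    (v : Coord d) : p.2 (vecOfComponents e p.1 v) = inner ℝ (components e p) v := by
  rw [vecOfComponents_eq_sum, map_sum, PiLp.inner_apply]
  simp [components]

variable {e : OpenPartialHomeomorph M (Coord d)} {x : M}

lemma IsCoordSystem.mdifferentiable (he : IsCoordSystem e) : e.MDifferentiable (𝓡 d) (𝓡 d) :=
  have he₁ : e ∈ IsManifold.maximalAtlas (𝓡 d) 1 M :=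
    IsManifold.maximalAtlas_subset_of_le (by simp) he
  ⟨fun _ hx => (mdifferentiableAt_of_mem_maximalAtlas he₁ hx).mdifferentiableWithinAt,
    fun _ hx => (mdifferentiableAt_symm_of_mem_maximalAtlas he₁ hx).mdifferentiableWithinAt⟩

lemma vecOfComponents_eq_mfderiv_symm (he : IsCoordSystem e) (hx : x ∈ e.source) :
    vecOfComponents e x = mfderiv (𝓡 d) (𝓡 d) e.symm (e x) := by
  have h := he.mdifferentiable.comp_symm_deriv (e.map_source hx)
  rw [e.left_inv hx] at h
  exact ContinuousLinearMap.inverse_eq h (he.mdifferentiable.symm_comp_deriv hx)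

lemma vecOfComponents_vecComponents (he : IsCoordSystem e) (hx : x ∈ e.source)
    (v : TangentSpace (𝓡 d) x) : vecOfComponents e x (vecComponents e x v) = v := by
  rw [vecOfComponents_eq_mfderiv_symm he hx]
  exact DFunLike.congr_fun (he.mdifferentiable.symm_comp_deriv hx) v

lemma vecComponents_vecOfComponents (he : IsCoordSystem e) (hx : x ∈ e.source) (v : Coord d) :
    vecComponents e x (vecOfComponents e x v) = v := by
  have h := he.mdifferentiable.comp_symm_deriv (e.map_source hx)
  rw [e.left_inv hx, ← vecOfComponents_eq_mfderiv_symm he hx] at h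
  exact DFunLike.congr_fun h v

lemma vecOfComponents_ne_zero (he : IsCoordSystem e) (hx : x ∈ e.source) {v : Coord d}
    (hv : v ≠ 0) : vecOfComponents e x v ≠ 0 := fun h =>
  hv (by rw [← vecComponents_vecOfComponents he hx v, h, map_zero])

lemma dCoord_apply (he : IsCoordSystem e) (hx : x ∈ e.source) (α : Fin d)
    (v : TangentSpace (𝓡 d) x) : dCoord e x α v = vecComponents e x v α := by
  have hα := (EuclideanSpace.proj (𝕜 := ℝ) α : Coord d →L[ℝ] ℝ).hasFDerivAt (x := e x)
  exact DFunLike.congr_fun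
    (hα.hasMFDerivAt.comp x (he.mdifferentiable.mdifferentiableAt hx).hasMFDerivAt).mfderiv v

lemma components_covec (he : IsCoordSystem e) (hx : x ∈ e.source) (q : Coord d) :
    components e ⟨x, covec e x q⟩ = q := by
  ext β
  simp [components, covec, dCoord_apply he hx, ← vecOfComponents_single,
    vecComponents_vecOfComponents he hx]

lemma covec_ne_zero (he : IsCoordSystem e) (hx : x ∈ e.source) {q : Coord d} (hq : q ≠ 0) :
    covec e x q ≠ 0 := fun h => hq <| by
  rw [← components_covec he hx q, h]
  ext β
  simp [components]

lemma components_ne_zero {p : Cotangent d M} (he : IsCoordSystem e) (hx : p.1 ∈ e.source)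
    (hp : p.2 ≠ 0) : components e p ≠ 0 := fun h => hp <| by
  ext v
  rw [← vecOfComponents_vecComponents he hx v, apply_vecOfComponents, h, inner_zero_left]
  rfl

lemma contMDiffOn_vecOfComponents [IsManifold (𝓡 d) ∞ M] (he : IsCoordSystem e) (v : Coord d) :
    ContMDiffOn (𝓡 d) ((𝓡 d).prod (𝓡 d)) ∞
      (fun u => (⟨e.symm u, vecOfComponents e (e.symm u) v⟩ : TangentBundle (𝓡 d) M))
      e.target := by
  have hsymm : ContMDiffOn (𝓡 d) (𝓡 d) ∞ e.symm e.target := fun u hu =>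
    (contMDiffAt_symm_of_mem_maximalAtlas he hu).contMDiffWithinAt
  have hconst : ContMDiff (𝓡 d) ((𝓡 d).prod (𝓡 d)) ∞
      (fun u : Coord d => (⟨u, v⟩ : TangentBundle (𝓡 d) (Coord d))) := fun _ =>
    contMDiffAt_vectorSpace_iff_contDiffAt.2 contDiffAt_const
  refine ((hsymm.contMDiffOn_tangentMapWithin (m := ∞) (by simp)
    e.open_target.uniqueMDiffOn).comp hconst.contMDiffOn fun _ hu => hu).congr fun u hu => ?_
  rw [Function.comp_apply, tangentMapWithin, mfderivWithin_of_isOpen e.open_target hu,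
    vecOfComponents_eq_mfderiv_symm he (e.map_target hu), e.right_inv hu]
  rfl

end Coordinates

section Metric

variable {d : ℕ} {M : Type*} [MetricSpace M] [ChartedSpace (Coord d) M]
  [RiemannianBundle (fun x : M => TangentSpace (𝓡 d) x)]
  {e : OpenPartialHomeomorph M (Coord d)} {x : M}

lemma inner_vecOfComponents (e : OpenPartialHomeomorph M (Coord d)) (x : M) (v w : Coord d) :
    inner ℝ (vecOfComponents e x v) (vecOfComponents e x w) =
      ∑ α, ∑ β, metricMatrix e x α β * v α * w β := by
  simp only [vecOfComponents_eq_sum, sum_inner, inner_sum, real_inner_smul_left,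
    real_inner_smul_right, metricMatrix, Matrix.of_apply]
  rw [Finset.sum_comm]
  refine Finset.sum_congr rfl fun α _ => Finset.sum_congr rfl fun β _ => ?_
  ring

lemma metricMatrix_comm (e : OpenPartialHomeomorph M (Coord d)) (x : M) (α β : Fin d) :
    metricMatrix e x α β = metricMatrix e x β α :=
  real_inner_comm (coordVec e x β) (coordVec e x α)

lemma dMetric_comm (e : OpenPartialHomeomorph M (Coord d)) (x : M) (σ μ ν : Fin d) :
    dMetric e x σ μ ν = dMetric e x σ ν μ := by
  simp only [dMetric, metricMatrix_comm _ _ μ ν]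

lemma christoffel_comm (e : OpenPartialHomeomorph M (Coord d)) (x : M) (μ α ν : Fin d) :
    christoffel e x μ α ν = christoffel e x μ ν α := by
  simp only [christoffel, dMetric_comm e x _ α ν, add_comm (dMetric e x α _ ν)]

/-- The Christoffel symbols as a bilinear map, `Γ(v, w)^μ = Γ^μ_{αν} v^α w^ν`. -/
def christoffelMap (e : OpenPartialHomeomorph M (Coord d)) (x : M) :
    Coord d →ₗ[ℝ] Coord d →ₗ[ℝ] Coord d :=
  LinearMap.mk₂ ℝ (fun v w => WithLp.toLp 2 fun μ => ∑ α, ∑ ν, christoffel e x μ α ν * v α * w ν)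
    (fun _ _ _ => by ext; simp [mul_add, add_mul, Finset.sum_add_distrib])
    (fun _ _ _ => by ext; simp [Finset.mul_sum, mul_assoc, mul_left_comm])
    (fun _ _ _ => by ext; simp [mul_add, Finset.sum_add_distrib])
    (fun _ _ _ => by ext; simp [Finset.mul_sum, mul_left_comm])

lemma christoffelMap_apply (e : OpenPartialHomeomorph M (Coord d)) (x : M) (v w : Coord d)
    (μ : Fin d) :
    christoffelMap e x v w μ = ∑ α, ∑ ν, christoffel e x μ α ν * v α * w ν := rfl

lemma christoffelMap_comm (e : OpenPartialHomeomorph M (Coord d)) (x : M) (v w : Coord d) :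
    christoffelMap e x v w = christoffelMap e x w v := by
  ext μ
  simp only [christoffelMap_apply]
  rw [Finset.sum_comm]
  refine Finset.sum_congr rfl fun α _ => Finset.sum_congr rfl fun ν _ => ?_
  rw [christoffel_comm e x μ ν α]
  ring

lemma metricMatrix_posDef (he : IsCoordSystem e) (hx : x ∈ e.source) :
    (metricMatrix e x).PosDef := by
  refine Matrix.PosDef.of_dotProduct_mulVec_pos (by ext α β; simp [metricMatrix_comm e x α β])
    fun v hv => ?_
  have hpos : 0 < ∑ α, ∑ β, metricMatrix e x α β * v α * v β :=
    (real_inner_self_pos.2 (vecOfComponents_ne_zero he hx (v := WithLp.toLp 2 v)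
      (by simpa))).trans_eq (inner_vecOfComponents e x _ _)
  simpa only [dotProduct, Matrix.mulVec, Finset.mul_sum, star_trivial, mul_assoc, mul_left_comm]
    using hpos

lemma hamiltonian_pos [IsManifold (𝓡 d) ∞ M] {p : Cotangent d M} (hp : p.2 ≠ 0) :
    0 < hamiltonian p := by
  have hc : IsCoordSystem (chartAt (Coord d) p.1) := IsManifold.chart_mem_maximalAtlas p.1
  have hm := mem_chart_source (Coord d) p.1
  have hpos := (metricMatrix_posDef hc hm).inv.dotProduct_mulVec_pos
    (x := (components (chartAt (Coord d) p.1) p).ofLp) (by simpa using components_ne_zero hc hm hp)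
  rw [hamiltonian, Real.sqrt_pos]
  simpa only [dotProduct, Matrix.mulVec, Finset.mul_sum, star_trivial, mul_assoc, mul_left_comm]
    using hpos

lemma sum_metricMatrix_mul_christoffel (he : IsCoordSystem e) (hx : x ∈ e.source)
    (l α ν : Fin d) :
    ∑ μ, metricMatrix e x l μ * christoffel e x μ α ν =
      (1 / 2) * (dMetric e x α l ν + dMetric e x ν l α - dMetric e x l α ν) := by
  set D : Fin d → ℝ := fun s =>
    (1 / 2) * (dMetric e x α s ν + dMetric e x ν s α - dMetric e x s α ν)
  have hΓ : (fun μ => christoffel e x μ α ν) = (metricMatrix e x)⁻¹.mulVec D := by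
    ext μ
    simp only [christoffel, Matrix.mulVec, dotProduct, Finset.mul_sum, D, mul_left_comm]
  have hinv : IsUnit (metricMatrix e x).det := (metricMatrix_posDef he hx).det_pos.ne'.isUnit
  calc ∑ μ, metricMatrix e x l μ * christoffel e x μ α ν
      = (metricMatrix e x).mulVec (fun μ => christoffel e x μ α ν) l := rfl
    _ = D l := by rw [hΓ, Matrix.mulVec_mulVec, Matrix.mul_nonsing_inv _ hinv, Matrix.one_mulVec]

lemma dMetric_eq_sum_christoffel (he : IsCoordSystem e) (hx : x ∈ e.source) (σ α β : Fin d) :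
    dMetric e x σ α β = ∑ μ, metricMatrix e x α μ * christoffel e x μ σ β
      + ∑ μ, metricMatrix e x β μ * christoffel e x μ σ α := by
  rw [sum_metricMatrix_mul_christoffel he hx, sum_metricMatrix_mul_christoffel he hx,
    dMetric_comm e x σ β α, dMetric_comm e x α β σ, dMetric_comm e x β α σ]
  ring

section Smooth

variable [IsManifold (𝓡 d) ∞ M]
  [IsContMDiffRiemannianBundle (𝓡 d) ∞ (Coord d) (fun x : M => TangentSpace (𝓡 d) x)]

lemma contDiffOn_metricMatrix (he : IsCoordSystem e) (α β : Fin d) :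
    ContDiffOn ℝ ∞ (fun u => metricMatrix e (e.symm u) α β) e.target :=
  ((contMDiffOn_vecOfComponents he _).inner_bundle (contMDiffOn_vecOfComponents he _)).contDiffOn

end Smooth

end Metric

section LocalBounds

variable {d : ℕ} {M : Type*} [MetricSpace M] [ChartedSpace (Coord d) M] [IsManifold (𝓡 d) ∞ M]
  [RiemannianBundle (fun x : M => TangentSpace (𝓡 d) x)]
  [IsContMDiffRiemannianBundle (𝓡 d) ∞ (Coord d) (fun x : M => TangentSpace (𝓡 d) x)]
  {e : OpenPartialHomeomorph M (Coord d)} {z : M}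

lemma continuousAt_metricMatrix (he : IsCoordSystem e) (hz : z ∈ e.source) (α β : Fin d) :
    ContinuousAt (fun x => metricMatrix e x α β) z :=
  (e.symm.continuousAt_iff_continuousAt_comp_right hz).2
    ((contDiffOn_metricMatrix he α β).continuousOn.continuousAt
      (e.open_target.mem_nhds (e.map_source hz)))

lemma continuousAt_dMetric (he : IsCoordSystem e) (hz : z ∈ e.source) (σ α β : Fin d) :
    ContinuousAt (fun x => dMetric e x σ α β) z := by
  have hfderiv : ContinuousAt (fderiv ℝ fun u => metricMatrix e (e.symm u) α β) (e z) :=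
    ((contDiffOn_metricMatrix he α β).continuousOn_fderiv_of_isOpen e.open_target
      (by simp)).continuousAt (e.open_target.mem_nhds (e.map_source hz))
  exact (hfderiv.comp (e.continuousAt hz)).clm_apply continuousAt_const

lemma continuousAt_christoffel (he : IsCoordSystem e) (hz : z ∈ e.source) (μ α ν : Fin d) :
    ContinuousAt (fun x => christoffel e x μ α ν) z := by
  have hg : ContinuousAt (fun x => metricMatrix e x) z :=
    continuousAt_pi.2 fun α => continuousAt_pi.2 fun β => continuousAt_metricMatrix he hz α β
  have hdet : ContinuousAt Ring.inverse (metricMatrix e z).det := by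
    rw [Ring.inverse_eq_inv']
    exact continuousAt_inv₀ (metricMatrix_posDef he hz).det_pos.ne'
  have hinv : ContinuousAt (fun x => (metricMatrix e x)⁻¹) z :=
    (continuousAt_matrix_inv _ hdet).comp (f := fun x => metricMatrix e x) hg
  have hD := continuousAt_dMetric he hz
  exact continuousAt_const.mul (tendsto_finsetSum _ fun s _ =>
    (continuousAt_pi.1 (continuousAt_pi.1 hinv μ) s).mul
      (((hD α s ν).add (hD ν s α)).sub (hD s α ν)))

lemma continuousAt_norm_vecOfComponents (he : IsCoordSystem e) (hz : z ∈ e.source) (v : Coord d) :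
    ContinuousAt (fun p : M × Coord d => ‖vecOfComponents e p.1 p.2‖) (z, v) := by
  simp only [norm_eq_sqrt_real_inner, inner_vecOfComponents]
  refine ContinuousAt.sqrt (tendsto_finsetSum _ fun α _ => tendsto_finsetSum _ fun β _ => ?_)
  have hg : ContinuousAt (fun p : M × Coord d => metricMatrix e p.1 α β) (z, v) :=
    ContinuousAt.comp (g := fun x => metricMatrix e x α β) (f := Prod.fst) (x := (z, v))
      (continuousAt_metricMatrix he hz α β) continuousAt_fst
  exact (hg.mul (by fun_prop)).mul (by fun_prop)

lemma continuousAt_christoffelMap_self (he : IsCoordSystem e) (hz : z ∈ e.source) (v : Coord d) :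
    ContinuousAt (fun p : M × Coord d => christoffelMap e p.1 p.2 p.2) (z, v) := by
  refine (PiLp.continuous_toLp 2 _).continuousAt.comp (continuousAt_pi.2 fun μ =>
    tendsto_finsetSum _ fun α _ => tendsto_finsetSum _ fun ν _ => ?_)
  have hΓ : ContinuousAt (fun p : M × Coord d => christoffel e p.1 μ α ν) (z, v) :=
    ContinuousAt.comp (g := fun x => christoffel e x μ α ν) (f := Prod.fst) (x := (z, v))
      (continuousAt_christoffel he hz μ α ν) continuousAt_fst
  exact (hΓ.mul (by fun_prop)).mul (by fun_prop)

lemma exists_eventually_mul_norm_le_norm_vecOfComponents (he : IsCoordSystem e)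
    (hz : z ∈ e.source) :
    ∃ c > 0, ∀ᶠ x in 𝓝 z, ∀ v, c * ‖v‖ ≤ ‖vecOfComponents e x v‖ := by
  obtain ⟨c, hc, hcz⟩ := (isCompact_sphere (0 : Coord d) 1).exists_forall_le' (a := 0)
    (f := fun v => ‖vecOfComponents e z v‖)
    ((vecOfComponents e z).continuous.norm.continuousOn)
    fun v hv => norm_pos_iff.2 (vecOfComponents_ne_zero he hz (ne_zero_of_mem_unit_sphere ⟨v, hv⟩))
  refine ⟨c / 2, half_pos hc, ?_⟩
  have h := eventually_le_mul_norm_pow_of_homogeneous (n := 1) (C := -(c / 2)) one_ne_zero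
    (N := fun x v => -‖vecOfComponents e x v‖)
    (fun v => (continuousAt_norm_vecOfComponents he hz v).neg)
    (fun x r v hr => by simp [norm_smul, abs_of_nonneg hr])
    (fun v hv => neg_lt_neg ((half_lt_self hc).trans_le (hcz v (by simpa using hv))))
  filter_upwards [h] with x hx v
  linarith [hx v, pow_one ‖v‖]

lemma exists_eventually_norm_christoffelMap_self_le (he : IsCoordSystem e) (hz : z ∈ e.source) :
    ∃ C > 0, ∀ᶠ x in 𝓝 z, ∀ v, ‖christoffelMap e x v v‖ ≤ C * ‖v‖ ^ 2 := by
  have hcont := continuousAt_christoffelMap_self he hz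
  obtain ⟨C, hC⟩ := (isCompact_sphere (0 : Coord d) 1).exists_bound_of_continuousOn
    (f := fun v => christoffelMap e z v v) fun v _ =>
      ((hcont v).comp (f := fun v => (z, v)) (by fun_prop)).continuousWithinAt
  refine ⟨max C 0 + 1, by positivity, eventually_le_mul_norm_pow_of_homogeneous two_ne_zero
    (fun v => (hcont v).norm) (fun x r v hr => ?_) fun v hv => ?_⟩
  · simp [norm_smul, abs_of_nonneg hr, sq, mul_assoc]
  · exact (hC v (by simpa using hv)).trans_lt ((le_max_left C 0).trans_lt (lt_add_one _))

end LocalBounds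

section Paths

lemma hasDerivWithinAt_coord_iff {d : ℕ} {k : ℝ → Coord d} {k' : Coord d} {S : Set ℝ} {s : ℝ} :
    HasDerivWithinAt k k' S s ↔ ∀ μ, HasDerivWithinAt (fun r => k r μ) (k' μ) S s := by
  simp only [hasDerivWithinAt_iff_hasFDerivWithinAt, hasFDerivWithinAt_euclidean]
  exact forall_congr' fun μ => by congr!

lemma eventually_mem_source {X Y : Type*} [TopologicalSpace X] [TopologicalSpace Y]
    {e : OpenPartialHomeomorph X Y} {γ : ℝ → X} {S : Set ℝ} {s : ℝ} (hγ : ContinuousOn γ S)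
    (hs : s ∈ S) (hx : γ s ∈ e.source) : ∀ᶠ r in 𝓝[S] s, r ∈ S ∧ γ r ∈ e.source :=
  eventually_mem_nhdsWithin.and ((hγ s hs).eventually (e.open_source.mem_nhds hx))

variable {d : ℕ} {M : Type*} [MetricSpace M] [ChartedSpace (Coord d) M]
  {e : OpenPartialHomeomorph M (Coord d)} {γ : ℝ → M} {s c : ℝ}

/-- The components `γ̇^μ(s)` of the velocity of a path `γ : [0, 1] → M` in the local
coordinates `e`. -/
def coordVelocity (e : OpenPartialHomeomorph M (Coord d)) (γ : ℝ → M) (s : ℝ) : Coord d :=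
  derivWithin (fun r => e (γ r)) (Icc 0 1) s

section Smooth

variable (hγ : ContMDiffOn 𝓘(ℝ, ℝ) (𝓡 d) ∞ γ (Icc 0 1))
  (hs : s ∈ Icc (0 : ℝ) 1) (he : IsCoordSystem e) (hx : γ s ∈ e.source)

include hγ hs he hx

lemma contDiffWithinAt_coord : ContDiffWithinAt ℝ ∞ (fun r => e (γ r)) (Icc 0 1) s :=
  ((contMDiffAt_of_mem_maximalAtlas he hx).comp_contMDiffWithinAt s (hγ s hs)).contDiffWithinAt

lemma hasDerivWithinAt_coord :
    HasDerivWithinAt (fun r => e (γ r)) (coordVelocity e γ s) (Icc 0 1) s :=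
  ((contDiffWithinAt_coord hγ hs he hx).differentiableWithinAt (by simp)).hasDerivWithinAt

lemma derivWithin_coord_apply (μ : Fin d) :
    derivWithin (fun r => e (γ r) μ) (Icc 0 1) s = coordVelocity e γ s μ :=
  (hasDerivWithinAt_coord_iff.1 (hasDerivWithinAt_coord hγ hs he hx) μ).derivWithin
    (uniqueDiffOn_Icc zero_lt_one s hs)

lemma differentiableWithinAt_coordVelocity :
    DifferentiableWithinAt ℝ (coordVelocity e γ) (Icc 0 1) s :=
  (((contDiffWithinAt_coord hγ hs he hx).fderivWithin_right (m := 1)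
    (uniqueDiffOn_Icc zero_lt_one) (by norm_cast) hs).differentiableWithinAt
      one_ne_zero).clm_apply (differentiableWithinAt_const (1 : ℝ))

lemma derivWithin_derivWithin_coord_apply (μ : Fin d) :
    derivWithin (fun r => derivWithin (fun τ => e (γ τ) μ) (Icc 0 1) r) (Icc 0 1) s =
      derivWithin (coordVelocity e γ) (Icc 0 1) s μ := by
  have hV := (differentiableWithinAt_coordVelocity hγ hs he hx).hasDerivWithinAt
  refine HasDerivWithinAt.derivWithin ?_ (uniqueDiffOn_Icc zero_lt_one s hs)
  refine (hasDerivWithinAt_coord_iff.1 hV μ).congr_of_eventuallyEq_of_mem ?_ hs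
  filter_upwards [eventually_mem_source hγ.continuousOn hs hx] with r hr
  exact derivWithin_coord_apply hγ hr.1 he hr.2 μ

lemma vecOfComponents_coordVelocity :
    vecOfComponents e (γ s) (coordVelocity e γ s) = velocity γ s := by
  have hcomp : HasFDerivWithinAt (fun r => e (γ r))
      ((vecComponents e (γ s) ∘L mfderivWithin 𝓘(ℝ, ℝ) (𝓡 d) γ (Icc 0 1) s : ℝ →L[ℝ] Coord d))
      (Icc 0 1) s :=
    ((he.mdifferentiable.mdifferentiableAt hx).hasMFDerivAt.comp_hasMFDerivWithinAt s
      ((hγ s hs).mdifferentiableWithinAt (by simp)).hasMFDerivWithinAt).hasFDerivWithinAt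
  have hvel : coordVelocity e γ s = vecComponents e (γ s) (velocity γ s) :=
    hcomp.hasDerivWithinAt.derivWithin (uniqueDiffOn_Icc zero_lt_one s hs)
  rw [hvel, vecOfComponents_vecComponents he hx]

end Smooth

section Reparametrization

lemma mul_mem_Icc (hc : c ∈ Ioc (0 : ℝ) 1) (hs : s ∈ Icc (0 : ℝ) 1) : c * s ∈ Icc (0 : ℝ) 1 :=
  unitInterval.mul_mem (Ioc_subset_Icc_self hc) hs

lemma contMDiffOn_comp_mul (hγ : ContMDiffOn 𝓘(ℝ, ℝ) (𝓡 d) ∞ γ (Icc 0 1))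
    (hc : c ∈ Ioc (0 : ℝ) 1) : ContMDiffOn 𝓘(ℝ, ℝ) (𝓡 d) ∞ (fun r => γ (c * r)) (Icc 0 1) :=
  hγ.comp (contDiff_const.mul contDiff_id).contMDiff.contMDiffOn fun _ hr => mul_mem_Icc hc hr

lemma hasDerivWithinAt_comp_mul {E : Type*} [NormedAddCommGroup E] [NormedSpace ℝ E]
    {f : ℝ → E} {f' : E} (hc : c ∈ Ioc (0 : ℝ) 1)
    (hf : HasDerivWithinAt f f' (Icc 0 1) (c * s)) :
    HasDerivWithinAt (fun r => f (c * r)) (c • f') (Icc 0 1) s := by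
  have hmul : HasDerivWithinAt (fun r : ℝ => c * r) c (Icc 0 1) s := by
    simpa using (hasDerivWithinAt_id s (Icc (0 : ℝ) 1)).const_mul c
  exact hf.scomp s hmul fun r hr => mul_mem_Icc hc hr

variable (hγ : ContMDiffOn 𝓘(ℝ, ℝ) (𝓡 d) ∞ γ (Icc 0 1)) (hs : s ∈ Icc (0 : ℝ) 1)
  (hc : c ∈ Ioc (0 : ℝ) 1)

include hγ hs hc

lemma coordVelocity_comp_mul (he : IsCoordSystem e) (hx : γ (c * s) ∈ e.source) :
    coordVelocity e (fun r => γ (c * r)) s = c • coordVelocity e γ (c * s) :=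
  (hasDerivWithinAt_comp_mul hc (hasDerivWithinAt_coord hγ (mul_mem_Icc hc hs) he hx)).derivWithin
    (uniqueDiffOn_Icc zero_lt_one s hs)

lemma velocity_comp_mul [IsManifold (𝓡 d) ∞ M] :
    velocity (d := d) (fun r => γ (c * r)) s = c • velocity (d := d) γ (c * s) := by
  have he : IsCoordSystem (chartAt (Coord d) (γ (c * s))) := IsManifold.chart_mem_maximalAtlas _
  have hx := mem_chart_source (Coord d) (γ (c * s))
  rw [← vecOfComponents_coordVelocity (contMDiffOn_comp_mul hγ hc) hs he hx,
    coordVelocity_comp_mul hγ hs hc he hx, map_smul,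
    vecOfComponents_coordVelocity hγ (mul_mem_Icc hc hs) he hx]

end Reparametrization

variable [RiemannianBundle (fun x : M => TangentSpace (𝓡 d) x)]

lemma isGeodesic_iff : IsGeodesic (d := d) γ ↔ ContMDiffOn 𝓘(ℝ, ℝ) (𝓡 d) ∞ γ (Icc 0 1) ∧
    ∀ s ∈ Icc (0 : ℝ) 1, ∀ e : OpenPartialHomeomorph M (Coord d), IsCoordSystem e →
      γ s ∈ e.source → HasDerivWithinAt (coordVelocity e γ)
        (-christoffelMap e (γ s) (coordVelocity e γ s) (coordVelocity e γ s)) (Icc 0 1) s := by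
  refine ⟨fun ⟨hγ, heq⟩ => ⟨hγ, fun s hs e he hx => ?_⟩, fun ⟨hγ, hV⟩ => ⟨hγ, ?_⟩⟩
  · refine (differentiableWithinAt_coordVelocity hγ hs he hx).hasDerivWithinAt.congr_deriv ?_
    ext μ
    have hμ := heq s hs e he hx μ
    simp only [derivWithin_derivWithin_coord_apply hγ hs he hx,
      derivWithin_coord_apply hγ hs he hx] at hμ
    exact eq_neg_of_add_eq_zero_left hμ
  · intro s hs e he hx μ
    simp only [derivWithin_derivWithin_coord_apply hγ hs he hx,
      derivWithin_coord_apply hγ hs he hx,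
      (hV s hs e he hx).derivWithin (uniqueDiffOn_Icc zero_lt_one s hs)]
    exact neg_add_cancel _

lemma IsGeodesic.hasDerivWithinAt_coordVelocity (hγ : IsGeodesic (d := d) γ)
    (hs : s ∈ Icc (0 : ℝ) 1) (he : IsCoordSystem e) (hx : γ s ∈ e.source) :
    HasDerivWithinAt (coordVelocity e γ)
      (-christoffelMap e (γ s) (coordVelocity e γ s) (coordVelocity e γ s)) (Icc 0 1) s :=
  (isGeodesic_iff.1 hγ).2 s hs e he hx

lemma IsGeodesic.comp_mul (hγ : IsGeodesic (d := d) γ) (hc : c ∈ Ioc (0 : ℝ) 1) :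
    IsGeodesic (d := d) (fun r => γ (c * r)) := by
  have hγc := contMDiffOn_comp_mul hγ.smooth hc
  refine isGeodesic_iff.2 ⟨hγc, fun s hs e he hx => ?_⟩
  have hD := (hasDerivWithinAt_comp_mul hc
    (hγ.hasDerivWithinAt_coordVelocity (mul_mem_Icc hc hs) he hx)).const_smul c
  refine (hD.congr_of_eventuallyEq_of_mem ?_ hs).congr_deriv ?_
  · filter_upwards [eventually_mem_source hγc.continuousOn hs hx] with r hr
    exact coordVelocity_comp_mul hγ.smooth hr.1 hc he hr.2
  · rw [coordVelocity_comp_mul hγ.smooth hs hc he hx]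
    simp only [map_smul, LinearMap.smul_apply, smul_neg]

end Paths

section ParallelTransport

variable {d : ℕ} {M : Type*} [MetricSpace M] [ChartedSpace (Coord d) M]
  [RiemannianBundle (fun x : M => TangentSpace (𝓡 d) x)]
  {e : OpenPartialHomeomorph M (Coord d)} {x : M} {γ : ℝ → M} {s : ℝ}

lemma inner_christoffelMap_single (e : OpenPartialHomeomorph M (Coord d)) (x : M)
    (c V : Coord d) (α : Fin d) :
    inner ℝ c (christoffelMap e x (EuclideanSpace.single α 1) V) =
      ∑ μ, ∑ ν, christoffel e x μ α ν * c μ * V ν := by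
  simp only [PiLp.inner_apply, christoffelMap_apply]
  simp [Finset.sum_mul, mul_right_comm]

lemma IsParallelAlong.hasDerivWithinAt_inner_components
    {ζ : (s : ℝ) → TangentSpace (𝓡 d) (γ s) →L[ℝ] ℝ} (hζ : IsParallelAlong γ ζ)
    (hγ : ContMDiffOn 𝓘(ℝ, ℝ) (𝓡 d) ∞ γ (Icc 0 1)) (hs : s ∈ Icc (0 : ℝ) 1)
    (he : IsCoordSystem e) (hx : γ s ∈ e.source) {w : ℝ → Coord d} {w' : Coord d}
    (hw : HasDerivWithinAt w w' (Icc 0 1) s) :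
    HasDerivWithinAt (fun r => inner ℝ (components e ⟨γ r, ζ r⟩) (w r))
      (inner ℝ (components e ⟨γ s, ζ s⟩) (w' + christoffelMap e (γ s) (w s) (coordVelocity e γ s)))
      (Icc 0 1) s := by
  have hcomp : HasDerivWithinAt (fun r => components e ⟨γ r, ζ r⟩)
      (WithLp.toLp 2 fun α => inner ℝ (components e ⟨γ s, ζ s⟩)
        (christoffelMap e (γ s) (EuclideanSpace.single α 1) (coordVelocity e γ s)))
      (Icc 0 1) s := by
    refine hasDerivWithinAt_coord_iff.2 fun α => (hζ s hs e he hx α).congr_deriv ?_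
    simp only [inner_christoffelMap_single, derivWithin_coord_apply hγ hs he hx]
  refine (hcomp.inner ℝ hw).congr_deriv ?_
  rw [inner_add_right]
  congr 1
  conv_rhs => rw [← (EuclideanSpace.basisFun (Fin d) ℝ).sum_repr (w s)]
  simp [PiLp.inner_apply, inner_sum, Finset.mul_sum, mul_assoc]

lemma inner_vecOfComponents_christoffelMap (e : OpenPartialHomeomorph M (Coord d)) (x : M)
    (V v w : Coord d) :
    inner ℝ (vecOfComponents e x (christoffelMap e x V v)) (vecOfComponents e x w) =
      ∑ α, ∑ β, (∑ σ, (∑ μ, metricMatrix e x β μ * christoffel e x μ σ α) * V σ) * v α * w β := by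
  simp only [inner_vecOfComponents, christoffelMap_apply, Finset.sum_mul, Finset.mul_sum]
  rw [Finset.sum_comm]
  conv_rhs => rw [Finset.sum_comm]
  refine Finset.sum_congr rfl fun β _ => ?_
  rw [Finset.sum_comm]
  conv_rhs => rw [Finset.sum_comm]
  refine Finset.sum_congr rfl fun σ _ => ?_
  rw [Finset.sum_comm]
  refine Finset.sum_congr rfl fun α _ => Finset.sum_congr rfl fun μ _ => ?_
  rw [metricMatrix_comm e x μ β]
  ring

lemma sum_dMetric_mul_eq_inner (he : IsCoordSystem e) (hx : x ∈ e.source) (V v w : Coord d) :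
    ∑ α, ∑ β, (∑ σ, dMetric e x σ α β * V σ) * v α * w β =
      inner ℝ (vecOfComponents e x (christoffelMap e x V v)) (vecOfComponents e x w)
        + inner ℝ (vecOfComponents e x v) (vecOfComponents e x (christoffelMap e x V w)) := by
  rw [real_inner_comm (vecOfComponents e x (christoffelMap e x V w)),
    inner_vecOfComponents_christoffelMap, inner_vecOfComponents_christoffelMap, add_comm]
  simp only [dMetric_eq_sum_christoffel he hx, add_mul, Finset.sum_add_distrib]
  congr 1
  rw [Finset.sum_comm]
  simp only [mul_right_comm]

section Smooth

variable [IsManifold (𝓡 d) ∞ M]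
  [IsContMDiffRiemannianBundle (𝓡 d) ∞ (Coord d) (fun x : M => TangentSpace (𝓡 d) x)]

lemma hasDerivWithinAt_metricMatrix (hγ : ContMDiffOn 𝓘(ℝ, ℝ) (𝓡 d) ∞ γ (Icc 0 1))
    (hs : s ∈ Icc (0 : ℝ) 1) (he : IsCoordSystem e) (hx : γ s ∈ e.source) (α β : Fin d) :
    HasDerivWithinAt (fun r => metricMatrix e (γ r) α β)
      (∑ σ, dMetric e (γ s) σ α β * coordVelocity e γ s σ) (Icc 0 1) s := by
  have hdiff : DifferentiableAt ℝ (fun u => metricMatrix e (e.symm u) α β) (e (γ s)) :=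
    ((contDiffOn_metricMatrix he α β).contDiffAt
      (e.open_target.mem_nhds (e.map_source hx))).differentiableAt (by simp)
  have hchain := hdiff.hasFDerivAt.comp_hasDerivWithinAt s (hasDerivWithinAt_coord hγ hs he hx)
  refine (hchain.congr_of_eventuallyEq_of_mem ?_ hs).congr_deriv ?_
  · filter_upwards [eventually_mem_source hγ.continuousOn hs hx] with r hr
    rw [Function.comp_apply, e.left_inv hr.2]
  · conv_lhs => rw [← (EuclideanSpace.basisFun (Fin d) ℝ).sum_repr (coordVelocity e γ s)]
    simp [dMetric, pderiv, mul_comm]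

lemma hasDerivWithinAt_inner_vecOfComponents (hγ : ContMDiffOn 𝓘(ℝ, ℝ) (𝓡 d) ∞ γ (Icc 0 1))
    (hs : s ∈ Icc (0 : ℝ) 1) (he : IsCoordSystem e) (hx : γ s ∈ e.source) {w : ℝ → Coord d}
    {w' : Coord d} (hw : HasDerivWithinAt w w' (Icc 0 1) s) (v : Coord d) :
    HasDerivWithinAt
      (fun r => inner ℝ (vecOfComponents e (γ r) (w r)) (vecOfComponents e (γ r) v))
      (inner ℝ (vecOfComponents e (γ s) (w' + christoffelMap e (γ s) (coordVelocity e γ s) (w s)))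
          (vecOfComponents e (γ s) v)
        + inner ℝ (vecOfComponents e (γ s) (w s))
          (vecOfComponents e (γ s) (christoffelMap e (γ s) (coordVelocity e γ s) v)))
      (Icc 0 1) s := by
  simp only [inner_vecOfComponents e (γ _) (w _) v]
  have hsum := HasDerivWithinAt.fun_sum (u := Finset.univ) fun α _ =>
    HasDerivWithinAt.fun_sum (u := Finset.univ) fun β _ =>
    ((hasDerivWithinAt_metricMatrix hγ hs he hx α β).mul
      (hasDerivWithinAt_coord_iff.1 hw α)).mul_const (v β)
  refine hsum.congr_deriv ?_
  rw [map_add, inner_add_left, add_assoc, ← sum_dMetric_mul_eq_inner he hx, inner_vecOfComponents]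
  simp only [add_mul, Finset.sum_add_distrib]
  rw [add_comm]

lemma IsGeodesic.isParallelAlong_velocity (hγ : IsGeodesic (d := d) γ) :
    IsParallelAlong γ fun s => innerSL ℝ (velocity (d := d) γ s) := by
  intro s hs e he hx α
  have hD := hasDerivWithinAt_inner_vecOfComponents hγ.smooth hs he hx
    (hγ.hasDerivWithinAt_coordVelocity hs he hx) (EuclideanSpace.single α 1)
  simp only [neg_add_cancel, map_zero, inner_zero_left, zero_add] at hD
  refine (hD.congr_of_eventuallyEq_of_mem ?_ hs).congr_deriv ?_
  · filter_upwards [eventually_mem_source hγ.smooth.continuousOn hs hx] with r hr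
    rw [vecOfComponents_coordVelocity hγ.smooth hr.1 he hr.2]
    rfl
  · simp only [derivWithin_coord_apply hγ.smooth hs he hx]
    rw [← inner_christoffelMap_single, ← apply_vecOfComponents, christoffelMap_comm,
      vecOfComponents_coordVelocity hγ.smooth hs he hx]
    rfl

end Smooth

variable [IsManifold (𝓡 d) ∞ M]

lemma IsParallelAlong.apply_velocity {ζ : (s : ℝ) → TangentSpace (𝓡 d) (γ s) →L[ℝ] ℝ}
    (hζ : IsParallelAlong γ ζ) (hγ : IsGeodesic (d := d) γ) (hs : s ∈ Icc (0 : ℝ) 1) :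
    ζ s (velocity γ s) = ζ 0 (velocity γ 0) := by
  refine eq_apply_zero_of_hasDerivWithinAt_zero (f := fun r => ζ r (velocity γ r))
    (fun r hr => ?_) hs
  set e := chartAt (Coord d) (γ r)
  have he : IsCoordSystem e := IsManifold.chart_mem_maximalAtlas _
  have hx : γ r ∈ e.source := mem_chart_source _ _
  have hD := hζ.hasDerivWithinAt_inner_components hγ.smooth hr he hx
    (hγ.hasDerivWithinAt_coordVelocity hr he hx)
  rw [neg_add_cancel, inner_zero_right] at hD
  refine hD.congr_of_eventuallyEq_of_mem ?_ hr
  filter_upwards [eventually_mem_source hγ.smooth.continuousOn hr hx] with τ hτ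
  rw [← vecOfComponents_coordVelocity hγ.smooth hτ.1 he hτ.2]
  exact apply_vecOfComponents e ⟨γ τ, ζ τ⟩ _

end ParallelTransport

section ShortestGeodesics

variable {d : ℕ} {M : Type*} [MetricSpace M] [ChartedSpace (Coord d) M]
  [RiemannianBundle (fun x : M => TangentSpace (𝓡 d) x)]
  {e : OpenPartialHomeomorph M (Coord d)} {γ : ℝ → M} {x z : M} {s : ℝ}

lemma IsGeodesic.norm_sub_sub_coordVelocity_le (hγ : IsGeodesic (d := d) γ)
    (he : IsCoordSystem e) {B : ℝ} (hB : 0 ≤ B) (h : ∀ s ∈ Icc (0 : ℝ) 1, γ s ∈ e.source ∧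
      ‖christoffelMap e (γ s) (coordVelocity e γ s) (coordVelocity e γ s)‖ ≤ B) :
    ‖e (γ 1) - e (γ 0) - coordVelocity e γ 0‖ ≤ B :=
  norm_sub_sub_le_of_norm_deriv_deriv_le hB
    (fun s hs => hasDerivWithinAt_coord hγ.smooth hs he (h s hs).1)
    (fun s hs => hγ.hasDerivWithinAt_coordVelocity hs he (h s hs).1)
    (fun s hs => (norm_neg _).trans_le (h s hs).2)

variable [IsManifold (𝓡 d) ∞ M]
  [IsContMDiffRiemannianBundle (𝓡 d) ∞ (Coord d) (fun x : M => TangentSpace (𝓡 d) x)]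

lemma IsGeodesic.norm_velocity (hγ : IsGeodesic (d := d) γ) (hs : s ∈ Icc (0 : ℝ) 1) :
    ‖velocity (d := d) γ s‖ = ‖velocity (d := d) γ 0‖ := by
  have h : inner ℝ (velocity (d := d) γ s) (velocity γ s) =
      inner ℝ (velocity (d := d) γ 0) (velocity γ 0) :=
    hγ.isParallelAlong_velocity.apply_velocity hγ hs
  rw [norm_eq_sqrt_real_inner, h, ← norm_eq_sqrt_real_inner]

lemma IsGeodesic.pathELength_eq (hγ : IsGeodesic (d := d) γ) {a b : ℝ} (ha : 0 ≤ a)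
    (hb : b ≤ 1) :
    pathELength (𝓡 d) γ a b = ENNReal.ofReal ((b - a) * ‖velocity (d := d) γ 0‖) := by
  have hspeed : ∀ t ∈ Ioo a b, ‖mfderiv 𝓘(ℝ, ℝ) (𝓡 d) γ t (1 : ℝ)‖ₑ =
      ENNReal.ofReal ‖velocity (d := d) γ 0‖ := by
    intro t ht
    have ht' : t ∈ Ioo (0 : ℝ) 1 := ⟨ha.trans_lt ht.1, ht.2.trans_le hb⟩
    rw [← hγ.norm_velocity (Ioo_subset_Icc_self ht'), ofReal_norm, velocity,
      mfderivWithin_of_mem_nhds (Icc_mem_nhds ht'.1 ht'.2)]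
  rw [pathELength_eq_lintegral_mfderiv_Ioo]
  refine (setLIntegral_congr_fun measurableSet_Ioo hspeed).trans ?_
  rw [setLIntegral_const, Real.volume_Ioo, mul_comm, ENNReal.ofReal_mul' (norm_nonneg _)]

lemma IsShortestGeodesic.norm_velocity (hγ : IsShortestGeodesic (d := d) γ z x)
    (hs : s ∈ Icc (0 : ℝ) 1) : ‖velocity (d := d) γ s‖ = dist z x := by
  have h := hγ.shortest
  rw [hγ.isGeodesic.pathELength_eq le_rfl le_rfl, edist_dist, sub_zero, one_mul] at h
  rw [hγ.isGeodesic.norm_velocity hs]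
  exact (ENNReal.ofReal_eq_ofReal_iff (norm_nonneg _) dist_nonneg).1 h

lemma IsShortestGeodesic.norm_vecOfComponents_coordVelocity
    (hγ : IsShortestGeodesic (d := d) γ z x) (hs : s ∈ Icc (0 : ℝ) 1) (he : IsCoordSystem e)
    (hx : γ s ∈ e.source) : ‖vecOfComponents e (γ s) (coordVelocity e γ s)‖ = dist z x := by
  rw [vecOfComponents_coordVelocity hγ.isGeodesic.smooth hs he hx, hγ.norm_velocity hs]

variable [IsRiemannianManifold (𝓡 d) M]

lemma IsGeodesic.dist_le (hγ : IsGeodesic (d := d) γ) {a b : ℝ} (ha : 0 ≤ a) (hab : a ≤ b)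
    (hb : b ≤ 1) : dist (γ a) (γ b) ≤ (b - a) * ‖velocity (d := d) γ 0‖ := by
  have h : edist (γ a) (γ b) ≤ pathELength (𝓡 d) γ a b := by
    rw [IsRiemannianManifold.out (I := 𝓡 d) (γ a) (γ b)]
    exact riemannianEDist_le_pathELength
      ((hγ.smooth.mono (Icc_subset_Icc ha hb)).of_le (by norm_cast)) rfl rfl hab
  rw [hγ.pathELength_eq ha hb, edist_dist] at h
  exact (ENNReal.ofReal_le_ofReal_iff (mul_nonneg (sub_nonneg.2 hab) (norm_nonneg _))).1 h

lemma IsShortestGeodesic.dist_eq (hγ : IsShortestGeodesic (d := d) γ z x)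
    (hs : s ∈ Icc (0 : ℝ) 1) : dist z (γ s) = s * dist z x := by
  have h0 := hγ.isGeodesic.dist_le le_rfl hs.1 hs.2
  have h1 := hγ.isGeodesic.dist_le hs.1 hs.2 le_rfl
  rw [hγ.norm_velocity unitInterval.zero_mem, hγ.start] at h0
  rw [hγ.norm_velocity unitInterval.zero_mem, hγ.finish] at h1
  linarith [dist_triangle z (γ s) x]

lemma IsShortestGeodesic.comp_mul (hγ : IsShortestGeodesic (d := d) γ z x)
    (hs : s ∈ Ioc (0 : ℝ) 1) : IsShortestGeodesic (d := d) (fun r => γ (s * r)) z (γ s) where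
  isGeodesic := hγ.isGeodesic.comp_mul hs
  start := by simp [hγ.start]
  finish := by simp
  shortest := by
    rw [(hγ.isGeodesic.comp_mul hs).pathELength_eq le_rfl le_rfl,
      velocity_comp_mul hγ.isGeodesic.smooth unitInterval.zero_mem hs, norm_smul,
      Real.norm_of_nonneg hs.1.le, hγ.norm_velocity (by simp), edist_dist,
      hγ.dist_eq (Ioc_subset_Icc_self hs), sub_zero, one_mul]

lemma IsGeodesicNhd.mem_nhds {U : Set M} (hU : IsGeodesicNhd (d := d) z U) : U ∈ 𝓝 z := by
  obtain ⟨E, h0, -, rfl, hexp, -, -⟩ := hU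
  obtain ⟨γ, hγ, hstart, hfinish⟩ := hexp 0 h0
  have hz : γ 0 = z := congrArg TotalSpace.proj hstart
  have hv : ‖velocity (d := d) γ 0‖ = ‖(0 : TangentSpace (𝓡 d) z)‖ :=
    congrArg (fun p : TangentBundle (𝓡 d) M => ‖p.2‖) hstart
  have hdist := hγ.dist_le le_rfl zero_le_one le_rfl
  rw [hv, norm_zero, mul_zero, hz, hfinish] at hdist
  have hE : E 0 = z := (dist_le_zero.1 hdist).symm
  exact hE ▸ E.open_target.mem_nhds (E.map_source h0)

lemma exists_eventually_norm_sub_sub_coordVelocity_le (he : IsCoordSystem e)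
    (hz : z ∈ e.source) :
    ∃ K > 0, ∀ᶠ x in 𝓝 z, ∀ γ : ℝ → M, IsShortestGeodesic (d := d) γ z x →
      ‖e x - e z - coordVelocity e γ 0‖ ≤ K * dist z x ^ 2 := by
  obtain ⟨c, hc, hlow⟩ := exists_eventually_mul_norm_le_norm_vecOfComponents he hz
  obtain ⟨C, hC, hΓ⟩ := exists_eventually_norm_christoffelMap_self_le he hz
  obtain ⟨r, hr, hball⟩ := Metric.eventually_nhds_iff_ball.1
    ((hlow.and hΓ).and (e.open_source.mem_nhds hz))
  refine ⟨C / c ^ 2, by positivity, ?_⟩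
  filter_upwards [Metric.ball_mem_nhds z hr] with x hx γ hγ
  have hbound := hγ.isGeodesic.norm_sub_sub_coordVelocity_le he
    (B := C / c ^ 2 * dist z x ^ 2) (by positivity)
  rw [hγ.start, hγ.finish] at hbound
  refine hbound fun s hs => ?_
  have hmem : γ s ∈ Metric.ball z r := by
    rw [Metric.mem_ball'] at hx ⊢
    rw [hγ.dist_eq hs]
    exact (mul_le_of_le_one_left dist_nonneg hs.2).trans_lt hx
  obtain ⟨⟨hlow, hΓ⟩, hsource⟩ := hball _ hmem
  have hV : c * ‖coordVelocity e γ s‖ ≤ dist z x :=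
    (hlow _).trans_eq (hγ.norm_vecOfComponents_coordVelocity hs he hsource)
  refine ⟨hsource, (hΓ _).trans ?_⟩
  calc C * ‖coordVelocity e γ s‖ ^ 2 = C / c ^ 2 * (c * ‖coordVelocity e γ s‖) ^ 2 := by
        field_simp
    _ ≤ C / c ^ 2 * dist z x ^ 2 := by gcongr

lemma eventually_norm_sub_sub_coordVelocity_le_mul (he : IsCoordSystem e) (hz : z ∈ e.source)
    {δ : ℝ} (hδ : 0 < δ) :
    ∀ᶠ x in 𝓝 z, ∀ γ : ℝ → M, IsShortestGeodesic (d := d) γ z x →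
      ‖e x - e z - coordVelocity e γ 0‖ ≤ δ * ‖e x - e z‖ := by
  obtain ⟨K, hK, hquad⟩ := exists_eventually_norm_sub_sub_coordVelocity_le he hz
  set L := ‖vecOfComponents e z‖
  have hsmall : ∀ᶠ x in 𝓝 z, K * dist z x * L * (1 + δ) < δ := by
    have hcont : ContinuousAt (fun x => K * dist z x * L * (1 + δ)) z := by fun_prop
    exact hcont.eventually_lt continuousAt_const (by simpa using hδ)
  filter_upwards [hquad, hsmall] with x hquad hη γ hγ
  have hdist : dist z x ≤ L * ‖coordVelocity e γ 0‖ := by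
    obtain rfl := hγ.start
    rw [← hγ.norm_vecOfComponents_coordVelocity unitInterval.zero_mem he hz]
    exact ContinuousLinearMap.le_opNorm _ _
  set η := K * dist z x * L
  have hself : ‖e x - e z - coordVelocity e γ 0‖ ≤
      η * (‖e x - e z‖ + ‖e x - e z - coordVelocity e γ 0‖) := by
    calc ‖e x - e z - coordVelocity e γ 0‖ ≤ K * dist z x * dist z x :=
          (hquad γ hγ).trans_eq (by ring)
      _ ≤ K * dist z x * (L * ‖coordVelocity e γ 0‖) := by gcongr
      _ = η * ‖coordVelocity e γ 0‖ := by ring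
      _ ≤ η * (‖e x - e z‖ + ‖e x - e z - coordVelocity e γ 0‖) := by
        gcongr
        exact norm_le_norm_add_norm_sub _ _
  have hη1 : η < 1 := by nlinarith
  refine le_of_mul_le_mul_left ?_ (sub_pos.2 hη1)
  nlinarith [norm_nonneg (e x - e z)]

lemma mem_of_isClosed_cone_of_coordVelocity_mem (he : IsCoordSystem e) (hz : z ∈ e.source)
    {K : Set (Coord d)} (hK : IsClosed K) (hcone : ∀ c > (0 : ℝ), ∀ w ∈ K, c • w ∈ K)
    (h : ∀ᶠ x in 𝓝 z, ∃ γ : ℝ → M, IsShortestGeodesic (d := d) γ z x ∧ coordVelocity e γ 0 ∈ K)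
    (u : Coord d) : u ∈ K := by
  refine mem_of_isClosed_cone hK hcone (fun δ hδ => ?_) u
  have hx : Filter.Tendsto (fun w => e.symm (e z + w)) (𝓝 0) (𝓝 z) := by
    have : ContinuousAt (fun w => e.symm (e z + w)) 0 :=
      (e.continuousAt_symm (e.map_source hz)).comp_of_eq (by fun_prop) (add_zero _)
    simpa [ContinuousAt, e.left_inv hz] using this
  have htarget : ∀ᶠ w in 𝓝 0, e z + w ∈ e.target :=
    (by fun_prop : Continuous fun w => e z + w).continuousAt.eventually
      (e.open_target.mem_nhds (by simpa using e.map_source hz))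
  filter_upwards [htarget, hx.eventually h,
    hx.eventually (eventually_norm_sub_sub_coordVelocity_le_mul he hz hδ)]
    with w hw ⟨γ, hγ, hmem⟩ hle
  exact ⟨_, hmem, by simpa [e.right_inv hw] using hle γ hγ⟩

end ShortestGeodesics

lemma eq_of_symm_of_apply_self_eq {𝕜 E F : Type*} [Field 𝕜] [CharZero 𝕜] [AddCommGroup E]
    [Module 𝕜 E] [AddCommGroup F] [Module 𝕜 F] {B C : E →ₗ[𝕜] E →ₗ[𝕜] F} (hB : ∀ v w, B v w = B w v)
    (hC : ∀ v w, C v w = C w v) (h : ∀ v, B v v = C v v) : B = C := by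
  ext v w
  have hvw := h (v + w)
  simp only [map_add, LinearMap.add_apply, h, hB w v, hC w v] at hvw
  have htwo : (2 : 𝕜) • B v w = (2 : 𝕜) • C v w := by linear_combination (norm := module) hvw
  exact smul_right_injective F two_ne_zero htwo

section PhaseHessian

variable {d : ℕ} {M : Type*} [MetricSpace M] [ChartedSpace (Coord d) M]
  [RiemannianBundle (fun x : M => TangentSpace (𝓡 d) x)]

/-- The symmetric bilinear form `Γ^μ_{αν} ξ_μ vᵅ wᵛ + i ε h g_{αν} vᵅ wᵛ` of component vectors
`v`, `w` at `q = (x, ξ)`. For `q = Φ t p` and `h = hamiltonian p` it is the second differential of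
the phase at `x*`. -/
def phaseHessian (e : OpenPartialHomeomorph M (Coord d)) (ε h : ℝ) (q : Cotangent d M) :
    Coord d →ₗ[ℝ] Coord d →ₗ[ℝ] ℂ :=
  LinearMap.mk₂ ℝ (fun v w => (inner ℝ (components e q) (christoffelMap e q.1 v w) : ℝ) +
      Complex.I * ε * h * (inner ℝ (vecOfComponents e q.1 v) (vecOfComponents e q.1 w) : ℝ))
    (fun _ _ _ => by
      simp only [map_add, LinearMap.add_apply, inner_add_left, inner_add_right, Complex.ofReal_add]
      ring)
    (fun _ _ _ => by
      simp only [map_smul, LinearMap.smul_apply, real_inner_smul_left, real_inner_smul_right,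
        Complex.ofReal_mul, Complex.real_smul]
      ring)
    (fun _ _ _ => by simp only [map_add, inner_add_right, Complex.ofReal_add]; ring)
    (fun _ _ _ => by
      simp only [map_smul, real_inner_smul_right, Complex.ofReal_mul, Complex.real_smul]
      ring)

lemma phaseHessian_apply (e : OpenPartialHomeomorph M (Coord d)) (ε h : ℝ) (q : Cotangent d M)
    (v w : Coord d) : phaseHessian e ε h q v w =
      (inner ℝ (components e q) (christoffelMap e q.1 v w) : ℝ) +
        Complex.I * ε * h * (inner ℝ (vecOfComponents e q.1 v) (vecOfComponents e q.1 w) : ℝ) :=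
  rfl

lemma phaseHessian_comm (e : OpenPartialHomeomorph M (Coord d)) (ε h : ℝ) (q : Cotangent d M)
    (v w : Coord d) : phaseHessian e ε h q v w = phaseHessian e ε h q w v := by
  rw [phaseHessian_apply, phaseHessian_apply, christoffelMap_comm,
    real_inner_comm (vecOfComponents e q.1 v)]

lemma phaseHessian_self_im (e : OpenPartialHomeomorph M (Coord d)) (ε h : ℝ) (q : Cotangent d M)
    (v : Coord d) :
    (phaseHessian e ε h q v v).im = ε * h * ‖vecOfComponents e q.1 v‖ ^ 2 := by
  rw [phaseHessian_apply, real_inner_self_eq_norm_sq]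
  simp [-Complex.ofReal_pow]

lemma phaseHessian_apply_single (e : OpenPartialHomeomorph M (Coord d)) (ε h : ℝ)
    (q : Cotangent d M) (v : Coord d) (α : Fin d) :
    phaseHessian e ε h q v (EuclideanSpace.single α 1) =
      (∑ μ, ∑ ν, christoffel e q.1 μ α ν * components e q μ * v ν : ℝ) +
        Complex.I * ε * h * (∑ ν, metricMatrix e q.1 α ν * v ν : ℝ) := by
  have hg : inner ℝ (vecOfComponents e q.1 (EuclideanSpace.single α 1)) (vecOfComponents e q.1 v) =
      ∑ ν, metricMatrix e q.1 α ν * v ν := by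
    simp [inner_vecOfComponents]
  rw [phaseHessian_comm, phaseHessian_apply, hg, inner_christoffelMap_single]

end PhaseHessian

section PhaseExpansion

variable {d : ℕ} {M : Type*} [MetricSpace M] [ChartedSpace (Coord d) M] [IsManifold (𝓡 d) ∞ M]
  [RiemannianBundle (fun x : M => TangentSpace (𝓡 d) x)]
  {e : OpenPartialHomeomorph M (Coord d)} {x : M} {γ : ℝ → M}
  {ε : ℝ} {Φ : ℝ → Cotangent d M → Cotangent d M} {φ : ℝ → M → Cotangent d M → ℂ}
  {t : ℝ} {p : Cotangent d M}

lemma integral_parallel_velocity {ζ : (s : ℝ) → TangentSpace (𝓡 d) (γ s) →L[ℝ] ℝ}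
    (hγ : IsGeodesic (d := d) γ) (hζ : IsParallelAlong γ ζ) (he : IsCoordSystem e)
    (hx : γ 0 ∈ e.source) :
    ∫ s in (0 : ℝ)..1, ζ s (velocity γ s) =
      inner ℝ (components e ⟨γ 0, ζ 0⟩) (coordVelocity e γ 0) := by
  have hconst : EqOn (fun s => ζ s (velocity γ s)) (fun _ => ζ 0 (velocity γ 0)) (uIcc 0 1) :=
    fun s hs => hζ.apply_velocity hγ (uIcc_of_le (zero_le_one (α := ℝ)) ▸ hs)
  rw [intervalIntegral.integral_congr hconst, intervalIntegral.integral_const, sub_zero, one_smul,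
    ← vecOfComponents_coordVelocity hγ.smooth unitInterval.zero_mem he hx]
  exact apply_vecOfComponents e ⟨γ 0, ζ 0⟩ _

lemma IsLeviCivitaPhase.contDiffAt_comp (hφ : IsLeviCivitaPhase ε Φ φ) {E : Type*}
    [NormedAddCommGroup E] [NormedSpace ℝ E] {τ : E → ℝ} {X : E → M} {P : E → Cotangent d M} {a : E}
    (hτ : ContDiffAt ℝ ∞ τ a) (hX : ContMDiffAt 𝓘(ℝ, E) (𝓡 d) ∞ X a)
    (hP : ContMDiffAt 𝓘(ℝ, E) ((𝓡 d).prod 𝓘(ℝ, Coord d →L[ℝ] ℝ)) ∞ P a)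
    (hne : ∀ᶠ b in 𝓝 a, (P b).2 ≠ 0) :
    ContDiffAt ℝ ∞ (fun b => φ (τ b) (X b) (P b)) a := by
  have hmap := (hτ.contMDiffAt.prodMk (hX.prodMk hP)).contMDiffWithinAt (s := {b | (P b).2 ≠ 0})
  exact (((hφ.smooth (τ a, X a, P a) hne.self_of_nhds).comp a hmap fun _ hb => hb).contMDiffAt
    hne).contDiffAt

lemma IsLeviCivitaPhase.contDiffAt (hφ : IsLeviCivitaPhase ε Φ φ) (he : IsCoordSystem e)
    (hp : p.2 ≠ 0) {u : Coord d} (hu : u ∈ e.target) :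
    ContDiffAt ℝ ∞ (fun u => φ t (e.symm u) p) u :=
  hφ.contDiffAt_comp contDiffAt_const (contMDiffAt_symm_of_mem_maximalAtlas he hu)
    contMDiffAt_const (.of_forall fun _ => hp)

variable [IsContMDiffRiemannianBundle (𝓡 d) ∞ (Coord d) (fun x : M => TangentSpace (𝓡 d) x)]
  [IsRiemannianManifold (𝓡 d) M]

lemma IsLeviCivitaPhase.eventually_eq (hφ : IsLeviCivitaPhase ε Φ φ) (he : IsCoordSystem e)
    (hp : p.2 ≠ 0) (hz : (Φ t p).1 ∈ e.source) :
    ∀ᶠ x in 𝓝 (Φ t p).1, (∃ γ : ℝ → M, IsShortestGeodesic (d := d) γ (Φ t p).1 x) ∧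
      ∀ γ : ℝ → M, IsShortestGeodesic (d := d) γ (Φ t p).1 x →
        φ t x p = (inner ℝ (components e (Φ t p)) (coordVelocity e γ 0) : ℝ)
          + Complex.I * ε / 2 * hamiltonian p * (dist (Φ t p).1 x : ℂ) ^ 2 := by
  obtain ⟨U, hU, hform⟩ := hφ.formula t p hp
  filter_upwards [hU.mem_nhds] with x hx
  obtain ⟨γ, ζ, hγ, huniq, hζ, hstart, hval⟩ := hform x hx
  refine ⟨⟨γ, hγ⟩, fun γ' hγ' => ?_⟩
  have hV : coordVelocity e γ' 0 = coordVelocity e γ 0 :=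
    derivWithin_congr (fun r hr => congrArg e (huniq γ' hγ' hr))
      (congrArg e (huniq γ' hγ' unitInterval.zero_mem))
  rw [hval, integral_parallel_velocity hγ.isGeodesic hζ he (by rwa [hγ.start]), hV,
    congrArg (components e) hstart, dist_comm x]

lemma IsLeviCivitaPhase.apply_xStar (hφ : IsLeviCivitaPhase ε Φ φ) (hp : p.2 ≠ 0) :
    φ t (Φ t p).1 p = 0 := by
  have he : IsCoordSystem (chartAt (Coord d) (Φ t p).1) := IsManifold.chart_mem_maximalAtlas _
  have hz := mem_chart_source (Coord d) (Φ t p).1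
  obtain ⟨⟨γ, hγ⟩, h⟩ := (hφ.eventually_eq he hp hz).self_of_nhds
  have hx : γ 0 ∈ (chartAt (Coord d) (Φ t p).1).source := by rwa [hγ.start]
  have hV : coordVelocity (chartAt (Coord d) (Φ t p).1) γ 0 = 0 := by
    by_contra hne
    refine vecOfComponents_ne_zero he hx hne (norm_eq_zero.1 ?_)
    rw [hγ.norm_vecOfComponents_coordVelocity unitInterval.zero_mem he hx, dist_self]
  simp [h γ hγ, hV]

lemma IsLeviCivitaPhase.eventually_eq_along (hφ : IsLeviCivitaPhase ε Φ φ) (he : IsCoordSystem e)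
    (hp : p.2 ≠ 0) (hz : (Φ t p).1 ∈ e.source)
    (hγ : IsShortestGeodesic (d := d) γ (Φ t p).1 x) :
    ∀ᶠ s in 𝓝[Icc 0 1] (0 : ℝ), φ t (γ s) p =
      s • ((inner ℝ (components e (Φ t p)) (coordVelocity e γ 0) : ℝ) : ℂ) +
        s ^ 2 • (Complex.I * ε / 2 * hamiltonian p * (dist (Φ t p).1 x : ℂ) ^ 2) := by
  have hγ0 : Filter.Tendsto γ (𝓝[Icc 0 1] (0 : ℝ)) (𝓝 (Φ t p).1) := by
    simpa only [ContinuousWithinAt, hγ.start] using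
      hγ.isGeodesic.smooth.continuousOn 0 unitInterval.zero_mem
  filter_upwards [hγ0.eventually (hφ.eventually_eq he hp hz), eventually_mem_nhdsWithin]
    with s hs hs1
  rcases hs1.1.eq_or_lt with rfl | hpos
  · simp [hγ.start, hφ.apply_xStar hp]
  · have hsI : s ∈ Ioc (0 : ℝ) 1 := ⟨hpos, hs1.2⟩
    rw [hs.2 _ (hγ.comp_mul hsI), coordVelocity_comp_mul hγ.isGeodesic.smooth
      unitInterval.zero_mem hsI he (by rwa [mul_zero, hγ.start]), mul_zero, hγ.dist_eq hs1,
      real_inner_smul_right]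
    simp only [Complex.real_smul]
    push_cast
    ring

lemma IsLeviCivitaPhase.fderiv_coordVelocity (hφ : IsLeviCivitaPhase ε Φ φ)
    (he : IsCoordSystem e) (hp : p.2 ≠ 0) (hz : (Φ t p).1 ∈ e.source)
    (hγ : IsShortestGeodesic (d := d) γ (Φ t p).1 x) :
    let f := fun u => φ t (e.symm u) p
    let V := coordVelocity e γ 0
    fderiv ℝ f (e (Φ t p).1) V = (inner ℝ (components e (Φ t p)) V : ℝ) ∧
    fderiv ℝ (fderiv ℝ f) (e (Φ t p).1) V V -
        fderiv ℝ f (e (Φ t p).1) (christoffelMap e (Φ t p).1 V V) =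
      Complex.I * ε * hamiltonian p * (dist (Φ t p).1 x : ℂ) ^ 2 := by
  intro f V
  have hx : γ 0 ∈ e.source := by rwa [hγ.start]
  have hsource := eventually_mem_source hγ.isGeodesic.smooth.continuousOn unitInterval.zero_mem hx
  have h := fderiv_fderiv_apply_of_eq_along_curve (f := f) (k := fun r => e (γ r))
    ((hφ.contDiffAt he hp (e.map_source hx)).of_le (by norm_cast))
    (hsource.mono fun s hs => hasDerivWithinAt_coord hγ.isGeodesic.smooth hs.1 he hs.2)
    (hγ.isGeodesic.hasDerivWithinAt_coordVelocity unitInterval.zero_mem he hx)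
    (by
      filter_upwards [hφ.eventually_eq_along he hp hz hγ, hsource] with s hs hsx
      simpa only [f, e.left_inv hsx.2] using hs)
  simp only [hγ.start, map_neg, ← sub_eq_add_neg] at h
  refine ⟨h.1, h.2.trans ?_⟩
  rw [Complex.real_smul]
  push_cast
  ring

lemma IsLeviCivitaPhase.fderiv_xStar (hφ : IsLeviCivitaPhase ε Φ φ) (he : IsCoordSystem e)
    (hp : p.2 ≠ 0) (hz : (Φ t p).1 ∈ e.source) (v : Coord d) :
    fderiv ℝ (fun u => φ t (e.symm u) p) (e (Φ t p).1) v =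
      (inner ℝ (components e (Φ t p)) v : ℝ) := by
  refine mem_of_isClosed_cone_of_coordVelocity_mem he hz (K := {v | fderiv ℝ (fun u =>
    φ t (e.symm u) p) (e (Φ t p).1) v = (inner ℝ (components e (Φ t p)) v : ℝ)})
    (isClosed_eq (by fun_prop) (by fun_prop)) (fun c _ w hw => ?_) ?_ v
  · simp only [mem_ofPred_eq, map_smul] at hw ⊢
    rw [hw, Complex.real_smul, ← Complex.ofReal_mul, real_inner_smul_right]
  · filter_upwards [hφ.eventually_eq he hp hz] with x hx
    obtain ⟨γ, hγ⟩ := hx.1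
    exact ⟨γ, hγ, (hφ.fderiv_coordVelocity he hp hz hγ).1⟩

lemma IsLeviCivitaPhase.fderiv_fderiv_xStar_self (hφ : IsLeviCivitaPhase ε Φ φ)
    (he : IsCoordSystem e) (hp : p.2 ≠ 0) (hz : (Φ t p).1 ∈ e.source) (v : Coord d) :
    fderiv ℝ (fderiv ℝ (fun u => φ t (e.symm u) p)) (e (Φ t p).1) v v =
      phaseHessian e ε (hamiltonian p) (Φ t p) v v := by
  set B := phaseHessian e ε (hamiltonian p) (Φ t p)
  have hcont : Continuous fun v => B v v := by
    simp_rw [← B.toContinuousBilinearMap_apply]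
    fun_prop
  refine mem_of_isClosed_cone_of_coordVelocity_mem he hz (K := {v | fderiv ℝ (fderiv ℝ fun u =>
    φ t (e.symm u) p) (e (Φ t p).1) v v = B v v})
    (isClosed_eq (by fun_prop) hcont) (fun c _ w hw => ?_) ?_ v
  · simp only [mem_ofPred_eq, map_smul, smul_apply, LinearMap.smul_apply] at hw ⊢
    rw [hw]
  · filter_upwards [hφ.eventually_eq he hp hz] with x hx
    obtain ⟨γ, hγ⟩ := hx.1
    have hγz : γ 0 ∈ e.source := by rwa [hγ.start]
    have hnorm := hγ.norm_vecOfComponents_coordVelocity unitInterval.zero_mem he hγz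
    rw [hγ.start] at hnorm
    have hV := (hφ.fderiv_coordVelocity he hp hz hγ).2
    rw [hφ.fderiv_xStar he hp hz, sub_eq_iff_eq_add'] at hV
    refine ⟨γ, hγ, hV.trans ?_⟩
    rw [phaseHessian_apply, real_inner_self_eq_norm_sq, hnorm, Complex.ofReal_pow]

lemma IsLeviCivitaPhase.fderiv_fderiv_xStar (hφ : IsLeviCivitaPhase ε Φ φ)
    (he : IsCoordSystem e) (hp : p.2 ≠ 0) (hz : (Φ t p).1 ∈ e.source) (v w : Coord d) :
    fderiv ℝ (fderiv ℝ (fun u => φ t (e.symm u) p)) (e (Φ t p).1) v w =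
      phaseHessian e ε (hamiltonian p) (Φ t p) v w := by
  set f := fun u => φ t (e.symm u) p
  have hsymm : IsSymmSndFDerivAt ℝ f (e (Φ t p).1) :=
    (hφ.contDiffAt he hp (e.map_source hz)).isSymmSndFDerivAt (by simp; norm_cast)
  let A : Coord d →ₗ[ℝ] Coord d →ₗ[ℝ] ℂ := (fderiv ℝ (fderiv ℝ f) (e (Φ t p).1)).toLinearMap₁₂
  have hA : A = phaseHessian e ε (hamiltonian p) (Φ t p) :=
    eq_of_symm_of_apply_self_eq hsymm (phaseHessian_comm e _ _ _)
      (hφ.fderiv_fderiv_xStar_self he hp hz)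
  exact LinearMap.congr_fun₂ hA v w

end PhaseExpansion

lemma pderiv_coord {d : ℕ} {f : Coord d → Coord d} {q : Coord d}
    (hf : DifferentiableAt ℝ f q) (β ν : Fin d) :
    pderiv (fun q => f q ν) q β = pderiv f q β ν :=
  DFunLike.congr_fun ((EuclideanSpace.proj (𝕜 := ℝ) ν).hasFDerivAt.comp q hf.hasFDerivAt).fderiv _

section PhaseDifferential

variable {d : ℕ} {M : Type*} [MetricSpace M] [ChartedSpace (Coord d) M]

/-- The differential of the phase in `x`, in local coordinates, as a function of `((t, η), x)`. -/
def phaseDifferential (φ : ℝ → M → Cotangent d M → ℂ) (e ey : OpenPartialHomeomorph M (Coord d))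
    (y : M) (p : (ℝ × Coord d) × Coord d) : Coord d →L[ℝ] ℂ :=
  fderiv ℝ (fun u => phaseInCoords φ e ey p.1.1 y u p.1.2) p.2

variable [IsManifold (𝓡 d) ∞ M] {e ey : OpenPartialHomeomorph M (Coord d)} {y : M}

lemma contMDiff_covec (ey : OpenPartialHomeomorph M (Coord d)) (y : M) :
    ContMDiff 𝓘(ℝ, Coord d) ((𝓡 d).prod 𝓘(ℝ, Coord d →L[ℝ] ℝ)) ∞
      (fun q : Coord d => (⟨y, covec ey y q⟩ : Cotangent d M)) := by
  intro q₀
  let T := trivializationAt (Coord d →L[ℝ] ℝ) (fun x : M => TangentSpace (𝓡 d) x →L[ℝ] ℝ) y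
  have hT (q : Coord d) :
      (T ⟨y, covec ey y q⟩).2 = ∑ α, q α • T.linearMapAt ℝ y (dCoord ey y α) := by
    have hlin := congrFun (T.coe_linearMapAt_of_mem (R := ℝ) (mem_baseSet_trivializationAt _ _ y))
      (covec ey y q)
    exact hlin.symm.trans (by simp only [covec, map_sum, map_smul])
  have hsmooth : ContDiff ℝ ∞ fun q : Coord d => ∑ α, q α • T.linearMapAt ℝ y (dCoord ey y α) := by
    fun_prop
  exact contMDiffAt_totalSpace.2 ⟨contMDiffAt_const,
    hsmooth.contDiffAt.contMDiffAt.congr_of_eventuallyEq (.of_forall hT)⟩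

variable [RiemannianBundle (fun x : M => TangentSpace (𝓡 d) x)]
  {ε : ℝ} {Φ : ℝ → Cotangent d M → Cotangent d M} {φ : ℝ → M → Cotangent d M → ℂ}
  {t : ℝ} {q u : Coord d}

lemma IsLeviCivitaPhase.contDiffAt_phaseInCoords (hφ : IsLeviCivitaPhase ε Φ φ)
    (he : IsCoordSystem e) (hey : IsCoordSystem ey) (hy : y ∈ ey.source) (hq : q ≠ 0)
    (hu : u ∈ e.target) :
    ContDiffAt ℝ ∞ (fun p : (ℝ × Coord d) × Coord d => phaseInCoords φ e ey p.1.1 y p.2 p.1.2)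
      ((t, q), u) := by
  refine hφ.contDiffAt_comp (by fun_prop)
    ((contMDiffAt_symm_of_mem_maximalAtlas he hu).comp ((t, q), u) (f := Prod.snd)
      contDiffAt_snd.contMDiffAt)
    ((contMDiff_covec ey y).contMDiffAt.comp ((t, q), u) (f := fun p => p.1.2)
      contDiffAt_fst.snd.contMDiffAt) ?_
  have hne : ∀ᶠ p : (ℝ × Coord d) × Coord d in 𝓝 ((t, q), u), p.1.2 ≠ 0 :=
    (by fun_prop : ContinuousAt (fun p : (ℝ × Coord d) × Coord d => p.1.2) _).eventually_ne hq
  exact hne.mono fun p hp => covec_ne_zero hey hy hp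

lemma IsLeviCivitaPhase.contDiffAt_phaseDifferential (hφ : IsLeviCivitaPhase ε Φ φ)
    (he : IsCoordSystem e) (hey : IsCoordSystem ey) (hy : y ∈ ey.source) (hq : q ≠ 0)
    (hu : u ∈ e.target) : ContDiffAt ℝ 1 (phaseDifferential φ e ey y) ((t, q), u) :=
  contDiffAt_fderiv_comp_prodMk_right (by norm_cast)
    (hφ.contDiffAt_phaseInCoords he hey hy hq hu)

lemma IsLeviCivitaPhase.mixedHessian_eq (hφ : IsLeviCivitaPhase ε Φ φ)
    (he : IsCoordSystem e) (hey : IsCoordSystem ey) (hy : y ∈ ey.source) (hq : q ≠ 0)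
    (hu : u ∈ e.target) (α β : Fin d) :
    mixedHessian φ e ey t y u q α β =
      fderiv ℝ (phaseDifferential φ e ey y) ((t, q), u) ((0, EuclideanSpace.single β 1), 0)
        (EuclideanSpace.single α 1) := by
  have hD := (hφ.contDiffAt_phaseDifferential (t := t) he hey hy hq hu).differentiableAt one_ne_zero
  have hcurve : HasFDerivAt (fun q' => ((t, q'), u)) ((.prod (.inr ℝ ℝ (Coord d)) 0)) q :=
    (hasFDerivAt_prodMk_right t q).prodMk (hasFDerivAt_const u q)
  have h := (ContinuousLinearMap.apply ℝ ℂ (EuclideanSpace.single α (1 : ℝ))).hasFDerivAt.comp q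
    (hD.hasFDerivAt.comp q hcurve)
  exact DFunLike.congr_fun h.fderiv (EuclideanSpace.single β 1)

variable [IsContMDiffRiemannianBundle (𝓡 d) ∞ (Coord d) (fun x : M => TangentSpace (𝓡 d) x)]
  [IsRiemannianManifold (𝓡 d) M]

lemma IsLeviCivitaPhase.phaseDifferential_xStar (hφ : IsLeviCivitaPhase ε Φ φ)
    (he : IsCoordSystem e) (hey : IsCoordSystem ey) (hy : y ∈ ey.source) (hq : q ≠ 0)
    (hx : (Φ t ⟨y, covec ey y q⟩).1 ∈ e.source) (v : Coord d) :
    phaseDifferential φ e ey y ((t, q), xStar Φ e ey t y q) v =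
      (inner ℝ (xiStar Φ e ey t y q) v : ℝ) :=
  hφ.fderiv_xStar he (covec_ne_zero hey hy hq) hx v

lemma IsLeviCivitaPhase.fderiv_phaseDifferential_xStar (hφ : IsLeviCivitaPhase ε Φ φ)
    (he : IsCoordSystem e) (hey : IsCoordSystem ey) (hy : y ∈ ey.source) (hq : q ≠ 0)
    (hx : (Φ t ⟨y, covec ey y q⟩).1 ∈ e.source) (v w : Coord d) :
    fderiv ℝ (phaseDifferential φ e ey y) ((t, q), xStar Φ e ey t y q) (0, v) w =
      phaseHessian e ε (hamiltonian (⟨y, covec ey y q⟩ : Cotangent d M))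
        (Φ t ⟨y, covec ey y q⟩) v w := by
  rw [← hφ.fderiv_fderiv_xStar he (covec_ne_zero hey hy hq) hx]
  have hD := (hφ.contDiffAt_phaseDifferential (t := t) he hey hy hq
    (e.map_source hx)).differentiableAt one_ne_zero
  exact (DFunLike.congr_fun (DFunLike.congr_fun (fderiv_comp_prodMk_right hD) v) w).symm

end PhaseDifferential

section Flow

variable {d : ℕ} {M : Type*} [MetricSpace M] [ChartedSpace (Coord d) M] [IsManifold (𝓡 d) ∞ M]
  [RiemannianBundle (fun x : M => TangentSpace (𝓡 d) x)]
  [IsContMDiffRiemannianBundle (𝓡 d) ∞ (Coord d) (fun x : M => TangentSpace (𝓡 d) x)]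
  [IsRiemannianManifold (𝓡 d) M] {e ey : OpenPartialHomeomorph M (Coord d)} {y : M}
  {ε : ℝ} {Φ : ℝ → Cotangent d M → Cotangent d M} {φ : ℝ → M → Cotangent d M → ℂ}
  {H : Cotangent d M → ℝ} {t : ℝ} {q : Coord d}

lemma IsLeviCivitaPhase.im_fderiv_phaseDifferential_xStar_ne_zero (hφ : IsLeviCivitaPhase ε Φ φ)
    (hε : ε ≠ 0) (he : IsCoordSystem e) (hey : IsCoordSystem ey) (hy : y ∈ ey.source) (hq : q ≠ 0)
    (hx : (Φ t ⟨y, covec ey y q⟩).1 ∈ e.source) {v : Coord d} (hv : v ≠ 0) :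
    (fderiv ℝ (phaseDifferential φ e ey y) ((t, q), xStar Φ e ey t y q) (0, v) v).im ≠ 0 := by
  have hh : hamiltonian (⟨y, covec ey y q⟩ : Cotangent d M) ≠ 0 :=
    (hamiltonian_pos (covec_ne_zero hey hy hq)).ne'
  rw [hφ.fderiv_phaseDifferential_xStar he hey hy hq hx, phaseHessian_self_im]
  exact mul_ne_zero (mul_ne_zero hε hh)
    (pow_ne_zero 2 (norm_ne_zero_iff.2 (vecOfComponents_ne_zero he hx hv)))

lemma IsLeviCivitaPhase.exists_contDiffAt_eq_xStar (hφ : IsLeviCivitaPhase ε Φ φ) (hε : ε ≠ 0)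
    (he : IsCoordSystem e) (hey : IsCoordSystem ey) (hy : y ∈ ey.source) (hq : q ≠ 0)
    (hx : (Φ t ⟨y, covec ey y q⟩).1 ∈ e.source) :
    ∃ X : ℝ × Coord d → Coord d, ContDiffAt ℝ 1 X (t, q) ∧
      ∀ᶠ a : (ℝ × Coord d) × M in 𝓝 ((t, q), (Φ t ⟨y, covec ey y q⟩).1),
        a.2 = (Φ a.1.1 ⟨y, covec ey y a.1.2⟩).1 → a.2 ∈ e.source ∧ e a.2 = X a.1 := by
  let u := xStar Φ e ey t y q
  let imCLM := ContinuousLinearMap.compL ℝ (Coord d) ℂ ℝ Complex.imCLM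
  let G := fun p => imCLM (phaseDifferential φ e ey y p)
  have hD := hφ.contDiffAt_phaseDifferential (t := t) he hey hy hq (e.map_source hx)
  have hdef : ∀ v, v ≠ 0 → fderiv ℝ G ((t, q), u) (0, v) v ≠ 0 := by
    intro v hv
    have hG := imCLM.hasFDerivAt.comp ((t, q), u) (hD.differentiableAt one_ne_zero).hasFDerivAt
    rw [show fderiv ℝ G ((t, q), u) (0, v) v = _ from congrArg (fun L => L (0, v) v) hG.fderiv]
    exact hφ.im_fderiv_phaseDifferential_xStar_ne_zero hε he hey hy hq hx hv
  have hzero {s : ℝ} {q' : Coord d} (hq' : q' ≠ 0) (hs : (Φ s ⟨y, covec ey y q'⟩).1 ∈ e.source) :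
      G ((s, q'), xStar Φ e ey s y q') = 0 := by
    ext v
    exact (congrArg Complex.im (hφ.phaseDifferential_xStar he hey hy hq' hs v)).trans
      (Complex.ofReal_im _)
  obtain ⟨X, hX, hXG⟩ := exists_contDiffAt_implicit_of_definite one_ne_zero
    (imCLM.contDiff.contDiffAt.comp ((t, q), u) hD) hdef
  have hcoord : ContinuousAt (fun a : (ℝ × Coord d) × M => (a.1, e a.2))
      ((t, q), (Φ t ⟨y, covec ey y q⟩).1) :=
    continuousAt_fst.prodMk ((e.continuousAt hx).comp (f := Prod.snd) continuousAt_snd)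
  have hne : ContinuousAt (fun a : (ℝ × Coord d) × M => a.1.2)
    ((t, q), (Φ t ⟨y, covec ey y q⟩).1) := by fun_prop
  refine ⟨X, hX, ?_⟩
  filter_upwards [hcoord.eventually hXG, hne.eventually_ne hq,
    continuousAt_snd.eventually_mem (e.open_source.mem_nhds hx)] with a ha haq has heq
  refine ⟨has, ha ?_⟩
  rw [heq] at has ⊢
  exact (hzero haq has).trans (hzero hq hx).symm

lemma IsHamiltonianFlow.continuousAt_base (hΦ : IsHamiltonianFlow H Φ)
    (hφ : IsLeviCivitaPhase ε Φ φ) (hε : ε ≠ 0) (hey : IsCoordSystem ey) (hy : y ∈ ey.source)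
    (hq : q ≠ 0) (t : ℝ) :
    ContinuousAt (fun a : ℝ × Coord d => (Φ a.1 ⟨y, covec ey y a.2⟩).1) (t, q) := by
  have hne : ∀ᶠ q' in 𝓝 q, covec ey y q' ≠ 0 :=
    (isOpen_ne.eventually_mem hq).mono fun q' hq' => covec_ne_zero hey hy hq'
  refine continuousAt_of_forall_isolated (t₁ := 0)
    (c := fun a : ℝ × Coord d => (Φ a.1 ⟨y, covec ey y a.2⟩).1)
    (hne.mono fun q' hq' => hΦ.continuous_base ⟨y, covec ey y q'⟩ hq') (fun s => ?_) ?_ t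
  · have he : IsCoordSystem (chartAt (Coord d) (Φ s ⟨y, covec ey y q⟩).1) :=
      IsManifold.chart_mem_maximalAtlas _
    have hx := mem_chart_source (Coord d) (Φ s ⟨y, covec ey y q⟩).1
    set e := chartAt (Coord d) (Φ s ⟨y, covec ey y q⟩).1
    obtain ⟨X, hX, hXeq⟩ := hφ.exists_contDiffAt_eq_xStar hε he hey hy hq hx
    have hXs : X (s, q) ∈ e.target := (hXeq.self_of_nhds rfl).2 ▸ e.map_source hx
    refine ⟨fun a => e.symm (X a), ?_, hXeq.mono fun a ha h => ?_⟩
    · filter_upwards [hX.eventually (by simp), hX.continuousAt.eventually_mem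
        (e.open_target.mem_nhds hXs)] with a ha hae
      exact (e.symm.continuousAt hae).comp ha.continuousAt
    · exact (e.left_inv (ha h).1).symm.trans (congrArg e.symm (ha h).2)
  · have hconst : (fun q' => (Φ 0 ⟨y, covec ey y q'⟩).1) =ᶠ[𝓝 q] fun _ => y :=
      hne.mono fun q' hq' => congrArg TotalSpace.proj (hΦ.initial ⟨y, covec ey y q'⟩ hq')
    exact continuousAt_const.congr hconst.symm

lemma IsHamiltonianFlow.differentiableAt_xStar (hΦ : IsHamiltonianFlow H Φ)
    (hφ : IsLeviCivitaPhase ε Φ φ) (hε : ε ≠ 0) (he : IsCoordSystem e) (hey : IsCoordSystem ey)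
    (hy : y ∈ ey.source) (hq : q ≠ 0) (hx : (Φ t ⟨y, covec ey y q⟩).1 ∈ e.source) :
    DifferentiableAt ℝ (xStar Φ e ey t y) q := by
  obtain ⟨X, hX, hXeq⟩ := hφ.exists_contDiffAt_eq_xStar hε he hey hy hq hx
  have hcont := hΦ.continuousAt_base hφ hε hey hy hq t
  have hslice : ContinuousAt (fun q' : Coord d => (t, q')) q := by fun_prop
  have heq : xStar Φ e ey t y =ᶠ[𝓝 q] fun q' => X (t, q') :=
    (hslice.eventually ((continuousAt_id.prodMk hcont).eventually hXeq)).mono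
      fun q' hq' => (hq' rfl).2
  exact ((hX.differentiableAt one_ne_zero).comp q (by fun_prop)).congr_of_eventuallyEq heq

lemma IsHamiltonianFlow.hasFDerivAt_xiStar (hΦ : IsHamiltonianFlow H Φ)
    (hφ : IsLeviCivitaPhase ε Φ φ) (hε : ε ≠ 0) (he : IsCoordSystem e) (hey : IsCoordSystem ey)
    (hy : y ∈ ey.source) (hq : q ≠ 0) (hx : (Φ t ⟨y, covec ey y q⟩).1 ∈ e.source) (α : Fin d) :
    HasFDerivAt (fun q => ((xiStar Φ e ey t y q α : ℝ) : ℂ))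
      (.apply ℝ ℂ (EuclideanSpace.single α 1) ∘L
        fderiv ℝ (phaseDifferential φ e ey y) ((t, q), xStar Φ e ey t y q) ∘L
          .prod (.inr ℝ ℝ (Coord d)) (fderiv ℝ (xStar Φ e ey t y) q)) q := by
  have hD := (hφ.contDiffAt_phaseDifferential (t := t) he hey hy hq
    (e.map_source hx)).differentiableAt one_ne_zero
  have hcurve : HasFDerivAt (fun q' => ((t, q'), xStar Φ e ey t y q')) _ q :=
    (hasFDerivAt_prodMk_right t q).prodMk
      (hΦ.differentiableAt_xStar hφ hε he hey hy hq hx).hasFDerivAt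
  have hcont : ContinuousAt (fun q' => (Φ t ⟨y, covec ey y q'⟩).1) q :=
    (hΦ.continuousAt_base hφ hε hey hy hq t).comp (f := fun q' => (t, q')) (by fun_prop)
  refine ((ContinuousLinearMap.hasFDerivAt _).comp q
    (hD.hasFDerivAt.comp q hcurve)).congr_of_eventuallyEq ?_
  filter_upwards [hcont.eventually_mem (e.open_source.mem_nhds hx), isOpen_ne.mem_nhds hq]
    with q' hxq' hq'
  refine Eq.symm ((hφ.phaseDifferential_xStar he hey hy hq' hxq' _).trans ?_)
  rw [EuclideanSpace.inner_single_right, one_mul, conj_trivial]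

lemma IsHamiltonianFlow.differentiableAt_xiStar (hΦ : IsHamiltonianFlow H Φ)
    (hφ : IsLeviCivitaPhase ε Φ φ) (hε : ε ≠ 0) (he : IsCoordSystem e) (hey : IsCoordSystem ey)
    (hy : y ∈ ey.source) (hq : q ≠ 0) (hx : (Φ t ⟨y, covec ey y q⟩).1 ∈ e.source) :
    DifferentiableAt ℝ (xiStar Φ e ey t y) q :=
  (differentiableAt_piLp 2).2 fun α => (Complex.reCLM.hasFDerivAt.comp q
    (hΦ.hasFDerivAt_xiStar hφ hε he hey hy hq hx α)).differentiableAt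

lemma IsHamiltonianFlow.mixedHessian_xStar (hΦ : IsHamiltonianFlow H Φ)
    (hφ : IsLeviCivitaPhase ε Φ φ) (hε : ε ≠ 0) (he : IsCoordSystem e) (hey : IsCoordSystem ey)
    (hy : y ∈ ey.source) (hq : q ≠ 0) (hx : (Φ t ⟨y, covec ey y q⟩).1 ∈ e.source) (α β : Fin d) :
    mixedHessian φ e ey t y (xStar Φ e ey t y q) q α β =
      (pderiv (fun q => xiStar Φ e ey t y q α) q β : ℝ) -
        phaseHessian e ε (hamiltonian (⟨y, covec ey y q⟩ : Cotangent d M))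
          (Φ t ⟨y, covec ey y q⟩) (pderiv (xStar Φ e ey t y) q β) (EuclideanSpace.single α 1) := by
  set w := pderiv (xStar Φ e ey t y) q β
  set D' := fderiv ℝ (phaseDifferential φ e ey y) ((t, q), xStar Φ e ey t y q)
  have hξ : ((pderiv (fun q => xiStar Φ e ey t y q α) q β : ℝ) : ℂ) =
      D' ((0, EuclideanSpace.single β 1), w) (EuclideanSpace.single α 1) :=
    DFunLike.congr_fun ((Complex.ofRealCLM.hasFDerivAt.comp q ((differentiableAt_piLp 2).1
      (hΦ.differentiableAt_xiStar hφ hε he hey hy hq hx) α).hasFDerivAt).unique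
      (hΦ.hasFDerivAt_xiStar hφ hε he hey hy hq hx α)) (EuclideanSpace.single β 1)
  have hsplit : D' ((0, EuclideanSpace.single β 1), w) =
      D' ((0, EuclideanSpace.single β 1), 0) + D' (0, w) := by
    rw [← map_add, Prod.mk_add_mk, zero_add, add_zero]
  rw [hφ.mixedHessian_eq (u := xStar Φ e ey t y q) he hey hy hq (e.map_source hx), hξ, hsplit,
    add_apply, hφ.fderiv_phaseDifferential_xStar he hey hy hq hx, add_sub_cancel_right]

end Flow

end LeviCivitaPhase

end

theorem theorem4p3_general {d : ℕ} {M : Type*} [MetricSpace M]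
    [ChartedSpace (Coord d) M] [IsManifold (𝓡 d) ∞ M]
    [RiemannianBundle (fun x : M => TangentSpace (𝓡 d) x)]
    [IsContMDiffRiemannianBundle (𝓡 d) ∞ (Coord d) (fun x : M => TangentSpace (𝓡 d) x)]
    [IsRiemannianManifold (𝓡 d) M] {H : Cotangent d M → ℝ}
    {Φ : ℝ → Cotangent d M → Cotangent d M} (hΦ : IsHamiltonianFlow H Φ)
    {ε : ℝ} (hε : ε ≠ 0)
    {φ : ℝ → M → Cotangent d M → ℂ} (hφ : IsLeviCivitaPhase ε Φ φ)
    {ex ey : OpenPartialHomeomorph M (Coord d)} (hex : IsCoordSystem ex) (hey : IsCoordSystem ey)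
    {t : ℝ} {y : M} (hy : y ∈ ey.source) {η : Coord d} (hη : η ≠ 0)
    (hx : (Φ t ⟨y, covec ey y η⟩).1 ∈ ex.source) :
    DifferentiableAt ℝ (xStar Φ ex ey t y) η ∧
    DifferentiableAt ℝ (xiStar Φ ex ey t y) η ∧
    ∀ α β : Fin d,
      mixedHessian φ ex ey t y (xStar Φ ex ey t y η) η α β
        = ((pderiv (fun q => xiStar Φ ex ey t y q α) η β : ℝ) : ℂ)
          - ((∑ μ, ∑ ν, christoffel ex (Φ t ⟨y, covec ey y η⟩).1 μ α ν * xiStar Φ ex ey t y η μ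
              * pderiv (fun q => xStar Φ ex ey t y q ν) η β : ℝ) : ℂ)
          - Complex.I * (ε : ℂ) * ((hamiltonian (⟨y, covec ey y η⟩ : Cotangent d M) : ℝ) : ℂ)
              * ((∑ ν, metricMatrix ex (Φ t ⟨y, covec ey y η⟩).1 α ν
                * pderiv (fun q => xStar Φ ex ey t y q ν) η β : ℝ) : ℂ) := by
  have hxStar := hΦ.differentiableAt_xStar hφ hε hex hey hy hη hx
  refine ⟨hxStar, hΦ.differentiableAt_xiStar hφ hε hex hey hy hη hx, fun α β => ?_⟩
  rw [hΦ.mixedHessian_xStar hφ hε hex hey hy hη hx, phaseHessian_apply_single, sub_sub]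
  simp only [pderiv_coord hxStar, xiStar]

theorem theorem4p3 {d : ℕ} (hd : 2 ≤ d)
    {M : Type*} [MetricSpace M] [CompactSpace M] [ConnectedSpace M]
    [ChartedSpace (Coord d) M] [IsManifold (𝓡 d) ∞ M]
    [RiemannianBundle (fun x : M => TangentSpace (𝓡 d) x)]
    [IsContMDiffRiemannianBundle (𝓡 d) ∞ (Coord d) (fun x : M => TangentSpace (𝓡 d) x)]
    [IsRiemannianManifold (𝓡 d) M]
    (Φ : ℝ → Cotangent d M → Cotangent d M) (hΦ : IsHamiltonianFlow hamiltonian Φ)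
    (ε : ℝ) (hε : 0 < ε)
    (φ : ℝ → M → Cotangent d M → ℂ) (hφ : IsLeviCivitaPhase ε Φ φ)
    -- arbitrary local coordinates near `x*` and near `y`
    (ex ey : OpenPartialHomeomorph M (Coord d)) (hex : IsCoordSystem ex) (hey : IsCoordSystem ey)
    (t : ℝ) (y : M) (hy : y ∈ ey.source)
    -- the components of a covector `η ≠ 0` at `y`
    (η : Coord d) (hη : η ≠ 0)
    (hx : (Φ t ⟨y, covec ey y η⟩).1 ∈ ex.source) :
    DifferentiableAt ℝ (xStar Φ ex ey t y) η ∧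
    DifferentiableAt ℝ (xiStar Φ ex ey t y) η ∧
    ∀ α β : Fin d,
      mixedHessian φ ex ey t y (xStar Φ ex ey t y η) η α β
        = ((pderiv (fun q => xiStar Φ ex ey t y q α) η β : ℝ) : ℂ)
          - ((∑ μ, ∑ ν, christoffel ex (Φ t ⟨y, covec ey y η⟩).1 μ α ν * xiStar Φ ex ey t y η μ
              * pderiv (fun q => xStar Φ ex ey t y q ν) η β : ℝ) : ℂ)
          - Complex.I * (ε : ℂ) * ((hamiltonian (⟨y, covec ey y η⟩ : Cotangent d M) : ℝ) : ℂ)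
              * ((∑ ν, metricMatrix ex (Φ t ⟨y, covec ey y η⟩).1 α ν
                * pderiv (fun q => xStar Φ ex ey t y q ν) η β : ℝ) : ℂ) :=
  theorem4p3_general hΦ hε.ne' hφ hex hey hy hη hx
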